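/- **Dynamic problem.** For a language $L$ over a finite alphabet $\Sigma$, the dynamic problem $\mathrm{Member}(L)$ has as data a sequence $w=w_0\dots w_{n-1}$ with $w_i\in\Sigma\cup\{\epsilon\}$, initially $w_i=\epsilon$ for all $i$. Its change operations are $\mathrm{set}_\sigma(i)$ for $\sigma\in\Sigma$ (sets $w_i$ to $\sigma$ if $w_i=\epsilon$) and $\mathrm{reset}(i)$ (sets $w_i$ to $\epsilon$); its only query operation is Boolean and asks whether $w_0\circ\cdots\circ w_{n-1}\in L$. For $k\in\mathbb N$ let $D_k$ be the Dyck language of all well-balanced strings over $k$ types of parentheses. **Dynamic programs.** A (Procedural-DynFO-)program stores an auxiliary structure with domain $[n]=\{0,\dots,n-1\}$ over a finite schema of relations and partial functions; it is initialised by first-order formulas over $([n],\le,+,\times)$. It may use finitely many supplementary instances, which are such programs for other operations on the same domain. For every change operation $\delta(\bar p)$ it has at most one update rule per auxiliary symbol $S$ (a symbol without a rule is unchanged). An update rule consists of an initial procedure $P_1$, a constraint $x_1\le g_1(n)\wedge\dots\wedge x_\ell\le g_\ell(n)$, terms $t_1,\dots,t_r$ over the auxiliary schema, and a main procedure $P_2$.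 It runs $P_1$ once and then, for each $\bar x\in[n]^\ell$ satisfying the constraint, sets $S(\bar t(\bar p,\bar x))$ to the value returned by $P_2$, a relation holding at a tuple if some such $\bar x$ yields true there. All rules of $\delta$ are evaluated on the old state. A query rule is a main procedure without variables $\bar x$. Procedures are built from assignments to local relations and functions, conditional branches and parallel branches (for $z\le g(n)$ pardo $P$; every assignment inside has $z$ among its arguments). Moreover, $P_1$ does not use $\bar x$ and may invoke change operations of supplementary instances outside parallel branches, where for each $\delta$ and each instance at most one rule does so; every path of $P_2$ ends with a return statement. Terms are built from variables, $+$, $\times$, $\bot$, auxiliary and local functions, if-then-else, functional queries to supplementary instances, and "the unique $z\le g(n)$ with $C$" (which must exist and be unique whenever evaluated). Conditions are Boolean combinations of $=$, $\le$, auxiliary and local relations, relational queries to supplementary instances, and $\exists z\le g(n)\,C$. All functions $g$ are first-order definable, i.e. one formula over $([n],\le,+,\times)$ defines $\{z\in[n]: z\le g(n)\}$ for every $n$. Concurrent assignments, and concurrent updates of a function, must agree. **Work.** The work $w$ is a function of $n$: variables and constants have work $1$; bounds $z\le g(n)$ in $\exists$, unique and parallel branches multiply the work of their body by $g(n)+1$;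 queries and changes of supplementary instances have the work of the corresponding rules of that instance (for a change, the maximum over its update rules); every other construct has the maximum of $1$ and the work of its parts. The work of an update rule is $\max\bigl(w(P_1),\ \prod_i (g_i(n)+1)\cdot\max(w(P_2),w(t_1),\dots,w(t_r))\bigr)$. The work of a change operation is the maximum over its update rules; the work of a query operation is that of its query rule. A dynamic problem is *maintainable in DynFO with $O(W(n))$ work* if a single such program (for all $n$) answers all its queries correctly after every finite sequence of change operations on the initial data, and every change and query operation has work $O(W(n))$ as $n\to\infty$. **Theorem.** For every fixed $k\in\mathbb N$, $\mathrm{Member}(D_k)$ is maintainable in DynFO with $O(n\log n+(\log n)^3)$ work. -/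

import Mathlib

open Filter Asymptotics

/-! ### First-order logic with arithmetic on the domain `[n] = Fin n` -/

/-- The relation symbols `≤`, `+`, `×` (the latter two as graphs). -/
inductive ArithRel : ℕ → Type
  | le : ArithRel 2
  | sum : ArithRel 3
  | prod : ArithRel 3

/-- The vocabulary of first-order logic with arithmetic. -/
def arith : FirstOrder.Language := ⟨fun _ => Empty, ArithRel⟩

/-- The canonical interpretation of `≤`, `+`, `×` on `[n]`. -/
instance arithStructure (n : ℕ) : arith.Structure (Fin n) where
  funMap := fun f _ => Empty.elim f
  RelMap := fun r =>
    match r with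
    | .le => fun v => v 0 ≤ v 1
    | .sum => fun v => (v 0 : ℕ) + (v 1 : ℕ) = (v 2 : ℕ)
    | .prod => fun v => (v 0 : ℕ) * (v 1 : ℕ) = (v 2 : ℕ)

/-- A first-order definable function `g : ℕ → ℕ`, used in constraints `z ≤ g(n)`: one formula
defines, in every domain `[n]`, the set of all `z ∈ [n]` with `z ≤ g(n)`. -/
structure Bound where
  fn : ℕ → ℕ
  definable : ∃ φ : arith.Formula Unit, ∀ (n : ℕ) (z : Fin n),
    φ.Realize (fun _ => z) ↔ (z : ℕ) ≤ fn n

/-! ### Schemas, structures, dynamic problems -/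

/-- A finite schema of relation symbols and function symbols. -/
structure Schema where
  Rel : Type
  Fn : Type
  [relFintype : Fintype Rel]
  [fnFintype : Fintype Fn]
  relAr : Rel → ℕ
  fnAr : Fn → ℕ

attribute [instance] Schema.relFintype Schema.fnFintype

/-- The schema without symbols. -/
def Schema.nil : Schema where
  Rel := Empty
  Fn := Empty
  relAr := Empty.elim
  fnAr := Empty.elim

/-- A structure over `τ` with domain `[n]`; functions are partial, `none` being `⊥`. -/
@[ext] structure Str (τ : Schema) (n : ℕ) where
  rel : (R : τ.Rel) → (Fin (τ.relAr R) → Fin n) → Prop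
  fn : (f : τ.Fn) → (Fin (τ.fnAr f) → Fin n) → Option (Fin n)

/-- The operations of a dynamic problem with their arities: change operations, relational queries
and functional queries. -/
structure OpSig where
  Chg : Type
  RQ : Type
  FQ : Type
  [chgFintype : Fintype Chg]
  [rqFintype : Fintype RQ]
  [fqFintype : Fintype FQ]
  chgAr : Chg → ℕ
  rqAr : RQ → ℕ
  fqAr : FQ → ℕ

attribute [instance] OpSig.chgFintype OpSig.rqFintype OpSig.fqFintype

/-- A dynamic problem: the data on domain `[n]`, the empty initial data, the effect of the change
operations and the answers to the query operations. -/
structure DynProblem where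
  sig : OpSig
  Data : ℕ → Type
  empty : (n : ℕ) → Data n
  chg : {n : ℕ} → (c : sig.Chg) → (Fin (sig.chgAr c) → Fin n) → Data n → Data n
  rq : {n : ℕ} → (q : sig.RQ) → (Fin (sig.rqAr q) → Fin n) → Data n → Prop
  fq : {n : ℕ} → (q : sig.FQ) → (Fin (sig.fqAr q) → Fin n) → Data n → Option (Fin n)

/-- What a dynamic program amounts to on the domain `[n]`: its states, the effect of its update
rules, the results of its query rules, whether the side conditions of the syntax are met when
a rule is evaluated (`...Ok`), and the work of its rules (`...Work`). -/
structure Machine (σ : OpSig) (n : ℕ) where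
  State : Type
  start : State
  chg : (c : σ.Chg) → (Fin (σ.chgAr c) → Fin n) → State → State
  rq : (q : σ.RQ) → (Fin (σ.rqAr q) → Fin n) → State → Prop
  fq : (q : σ.FQ) → (Fin (σ.fqAr q) → Fin n) → State → Option (Fin n)
  chgOk : (c : σ.Chg) → (Fin (σ.chgAr c) → Fin n) → State → Prop
  rqOk : (q : σ.RQ) → (Fin (σ.rqAr q) → Fin n) → State → Prop
  fqOk : (q : σ.FQ) → (Fin (σ.fqAr q) → Fin n) → State → Prop
  chgWork : σ.Chg → ℕ
  rqWork : σ.RQ → ℕ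
  fqWork : σ.FQ → ℕ

/-! ### Terms and conditions -/

/-- The two kinds of expressions. -/
inductive Kind
  | term
  | cond

/-- Terms and conditions over an auxiliary schema `τ`, a schema `loc` of symbols assigned earlier in
the same procedure, supplementary instances `i : I` with operations `sig i`, parameters
`p_0, …, p_{a-1}` of the operation and variables `x_0, …, x_{l-1}` of the update rule.
The last index is the number of local variables in scope. -/
inductive Expr (τ loc : Schema) {I : Type} (sig : I → OpSig) (a l : ℕ) : Kind → ℕ → Type
  | pvar {m : ℕ} (i : Fin a) : Expr τ loc sig a l .term m
  | xvar {m : ℕ} (i : Fin l) : Expr τ loc sig a l .term m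
  | zvar {m : ℕ} (i : Fin m) : Expr τ loc sig a l .term m
  | bot {m : ℕ} : Expr τ loc sig a l .term m
  | plus {m : ℕ} (s t : Expr τ loc sig a l .term m) : Expr τ loc sig a l .term m
  | times {m : ℕ} (s t : Expr τ loc sig a l .term m) : Expr τ loc sig a l .term m
  | auxFn {m : ℕ} (f : τ.Fn) (y : Fin (τ.fnAr f) → Expr τ loc sig a l .term m) :
      Expr τ loc sig a l .term m
  | locFn {m : ℕ} (f : loc.Fn) (y : Fin (loc.fnAr f) → Expr τ loc sig a l .term m) :
      Expr τ loc sig a l .term m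
  | ite {m : ℕ} (c : Expr τ loc sig a l .cond m) (s t : Expr τ loc sig a l .term m) :
      Expr τ loc sig a l .term m
  | fq {m : ℕ} (i : I) (q : (sig i).FQ)
      (y : Fin ((sig i).fqAr q) → Expr τ loc sig a l .term m) : Expr τ loc sig a l .term m
  /-- `unique z ≤ g(n) (c)` -/
  | unique {m : ℕ} (g : Bound) (c : Expr τ loc sig a l .cond (m + 1)) : Expr τ loc sig a l .term m
  | eq {m : ℕ} (s t : Expr τ loc sig a l .term m) : Expr τ loc sig a l .cond m
  | le {m : ℕ} (s t : Expr τ loc sig a l .term m) : Expr τ loc sig a l .cond m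
  | auxRel {m : ℕ} (R : τ.Rel) (y : Fin (τ.relAr R) → Expr τ loc sig a l .term m) :
      Expr τ loc sig a l .cond m
  | locRel {m : ℕ} (R : loc.Rel) (y : Fin (loc.relAr R) → Expr τ loc sig a l .term m) :
      Expr τ loc sig a l .cond m
  | rq {m : ℕ} (i : I) (q : (sig i).RQ)
      (y : Fin ((sig i).rqAr q) → Expr τ loc sig a l .term m) : Expr τ loc sig a l .cond m
  /-- `exists z ≤ g(n) (c)` -/
  | ex {m : ℕ} (g : Bound) (c : Expr τ loc sig a l .cond (m + 1)) : Expr τ loc sig a l .cond m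
  | not {m : ℕ} (c : Expr τ loc sig a l .cond m) : Expr τ loc sig a l .cond m
  | and {m : ℕ} (c d : Expr τ loc sig a l .cond m) : Expr τ loc sig a l .cond m
  | or {m : ℕ} (c d : Expr τ loc sig a l .cond m) : Expr τ loc sig a l .cond m

/-- Terms have a value in `[n] ∪ {⊥}`, conditions have a truth value. -/
abbrev Val (n : ℕ) : Kind → Type
  | .term => Option (Fin n)
  | .cond => Prop

/-- The tuple of the values if all of them are defined. -/
def tuple {k : ℕ} {α : Type} (v : Fin k → Option α) : Option (Fin k → α) :=
  if h : ∀ j, (v j).isSome then some (fun j => (v j).get (h j)) else none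

/-- What a procedure can read but not assign: the auxiliary structure, the states of the
supplementary instances, the values of `p` and of `x`. -/
structure Env (τ : Schema) {I : Type} {sig : I → OpSig} {n : ℕ} (M : (i : I) → Machine (sig i) n)
    (a l : ℕ) where
  aux : Str τ n
  inst : (i : I) → (M i).State
  p : Fin a → Fin n
  x : Fin l → Fin n

section Expressions

variable {τ loc : Schema} {I : Type} {sig : I → OpSig} {a l n : ℕ} {M : (i : I) → Machine (sig i) n}

open scoped Classical in
/-- The value of an expression. Symbols applied to an undefined argument give `⊥` and atomic
conditions (equality included) on undefined arguments are false; sums and products that leave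
the domain are `⊥`. -/
noncomputable def Expr.eval (E : Env τ M a l) (L : Str loc n) :
    {κ : Kind} → {m : ℕ} → Expr τ loc sig a l κ m → (Fin m → Fin n) → Val n κ
  | _, _, .pvar i, _ => some (E.p i)
  | _, _, .xvar i, _ => some (E.x i)
  | _, _, .zvar i, z => some (z i)
  | _, _, .bot, _ => none
  | _, _, .plus s t, z => (s.eval E L z).bind fun u => (t.eval E L z).bind fun v =>
      if h : (u : ℕ) + (v : ℕ) < n then some ⟨(u : ℕ) + (v : ℕ), h⟩ else none
  | _, _, .times s t, z => (s.eval E L z).bind fun u => (t.eval E L z).bind fun v =>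
      if h : (u : ℕ) * (v : ℕ) < n then some ⟨(u : ℕ) * (v : ℕ), h⟩ else none
  | _, _, .auxFn f y, z => (tuple fun j => (y j).eval E L z).bind (E.aux.fn f)
  | _, _, .locFn f y, z => (tuple fun j => (y j).eval E L z).bind (L.fn f)
  | _, _, .ite c s t, z => if c.eval E L z then s.eval E L z else t.eval E L z
  | _, _, .fq i q y, z =>
      (tuple fun j => (y j).eval E L z).bind fun b => (M i).fq q b (E.inst i)
  | _, _, .unique g c, z =>
      if h : ∃! b : Fin n, (b : ℕ) ≤ g.fn n ∧ c.eval E L (Fin.snoc z b) then some h.choose else none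
  | _, _, .eq s t, z => ∃ u, s.eval E L z = some u ∧ t.eval E L z = some u
  | _, _, .le s t, z => ∃ u v, s.eval E L z = some u ∧ t.eval E L z = some v ∧ u ≤ v
  | _, _, .auxRel R y, z => ∃ b, (tuple fun j => (y j).eval E L z) = some b ∧ E.aux.rel R b
  | _, _, .locRel R y, z => ∃ b, (tuple fun j => (y j).eval E L z) = some b ∧ L.rel R b
  | _, _, .rq i q y, z =>
      ∃ b, (tuple fun j => (y j).eval E L z) = some b ∧ (M i).rq q b (E.inst i)
  | _, _, .ex g c, z => ∃ b : Fin n, (b : ℕ) ≤ g.fn n ∧ c.eval E L (Fin.snoc z b)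
  | _, _, .not c, z => ¬ c.eval E L z
  | _, _, .and c d, z => c.eval E L z ∧ d.eval E L z
  | _, _, .or c d, z => c.eval E L z ∨ d.eval E L z

/-- Every `unique`-expression that is evaluated has exactly one witness. -/
def Expr.Ok (E : Env τ M a l) (L : Str loc n) :
    {κ : Kind} → {m : ℕ} → Expr τ loc sig a l κ m → (Fin m → Fin n) → Prop
  | _, _, .pvar _, _ => True
  | _, _, .xvar _, _ => True
  | _, _, .zvar _, _ => True
  | _, _, .bot, _ => True
  | _, _, .plus s t, z => s.Ok E L z ∧ t.Ok E L z
  | _, _, .times s t, z => s.Ok E L z ∧ t.Ok E L z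
  | _, _, .auxFn _ y, z => ∀ j, (y j).Ok E L z
  | _, _, .locFn _ y, z => ∀ j, (y j).Ok E L z
  | _, _, .ite c s t, z =>
      c.Ok E L z ∧ (c.eval E L z → s.Ok E L z) ∧ (¬ c.eval E L z → t.Ok E L z)
  | _, _, .fq i q y, z => (∀ j, (y j).Ok E L z) ∧
      ∀ b, (tuple fun j => (y j).eval E L z) = some b → (M i).fqOk q b (E.inst i)
  | _, _, .unique g c, z =>
      (∀ b : Fin n, (b : ℕ) ≤ g.fn n → c.Ok E L (Fin.snoc z b)) ∧
      ∃! b : Fin n, (b : ℕ) ≤ g.fn n ∧ c.eval E L (Fin.snoc z b)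
  | _, _, .eq s t, z => s.Ok E L z ∧ t.Ok E L z
  | _, _, .le s t, z => s.Ok E L z ∧ t.Ok E L z
  | _, _, .auxRel _ y, z => ∀ j, (y j).Ok E L z
  | _, _, .locRel _ y, z => ∀ j, (y j).Ok E L z
  | _, _, .rq i q y, z => (∀ j, (y j).Ok E L z) ∧
      ∀ b, (tuple fun j => (y j).eval E L z) = some b → (M i).rqOk q b (E.inst i)
  | _, _, .ex g c, z => ∀ b : Fin n, (b : ℕ) ≤ g.fn n → c.Ok E L (Fin.snoc z b)
  | _, _, .not c, z => c.Ok E L z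
  | _, _, .and c d, z => c.Ok E L z ∧ d.Ok E L z
  | _, _, .or c d, z => c.Ok E L z ∧ d.Ok E L z

/-- The work `w` of an expression. A bound `z ≤ g(n)` contributes the factor `g(n) + 1`, the number
of `z ∈ ℕ` it admits. -/
def Expr.work (M : (i : I) → Machine (sig i) n) :
    {κ : Kind} → {m : ℕ} → Expr τ loc sig a l κ m → ℕ
  | _, _, .pvar _ => 1
  | _, _, .xvar _ => 1
  | _, _, .zvar _ => 1
  | _, _, .bot => 1
  | _, _, .plus s t => max (s.work M) (t.work M)
  | _, _, .times s t => max (s.work M) (t.work M)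
  | _, _, .auxFn _ y => max 1 (Finset.univ.sup fun j => (y j).work M)
  | _, _, .locFn _ y => max 1 (Finset.univ.sup fun j => (y j).work M)
  | _, _, .ite c s t => max (c.work M) (max (s.work M) (t.work M))
  | _, _, .fq i q y => max ((M i).fqWork q) (Finset.univ.sup fun j => (y j).work M)
  | _, _, .unique g c => (g.fn n + 1) * c.work M
  | _, _, .eq s t => max (s.work M) (t.work M)
  | _, _, .le s t => max (s.work M) (t.work M)
  | _, _, .auxRel _ y => max 1 (Finset.univ.sup fun j => (y j).work M)
  | _, _, .locRel _ y => max 1 (Finset.univ.sup fun j => (y j).work M)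
  | _, _, .rq i q y => max ((M i).rqWork q) (Finset.univ.sup fun j => (y j).work M)
  | _, _, .ex g c => (g.fn n + 1) * c.work M
  | _, _, .not c => c.work M
  | _, _, .and c d => max (c.work M) (d.work M)
  | _, _, .or c d => max (c.work M) (d.work M)

end Expressions

/-! ### Procedures -/

/-- Instructions without change invocations and without return statements. At this level the local
variables in scope are exactly those bound by enclosing parallel branches; each of them has to occur
literally among the arguments of the head of an assignment. -/
inductive Instr (τ loc : Schema) {I : Type} (sig : I → OpSig) (a l : ℕ) : ℕ → Type
  | skip {m : ℕ} : Instr τ loc sig a l m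
  | seq {m : ℕ} (P Q : Instr τ loc sig a l m) : Instr τ loc sig a l m
  | setFn {m : ℕ} (f : loc.Fn) (y : Fin (loc.fnAr f) → Expr τ loc sig a l .term m)
      (t : Expr τ loc sig a l .term m) (occ : ∀ i : Fin m, ∃ j, y j = .zvar i) :
      Instr τ loc sig a l m
  | setRel {m : ℕ} (R : loc.Rel) (y : Fin (loc.relAr R) → Expr τ loc sig a l .term m)
      (c : Expr τ loc sig a l .cond m) (occ : ∀ i : Fin m, ∃ j, y j = .zvar i) :
      Instr τ loc sig a l m
  | ite {m : ℕ} (c : Expr τ loc sig a l .cond m) (P Q : Instr τ loc sig a l m) :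
      Instr τ loc sig a l m
  /-- `for z ≤ g(n) pardo P` -/
  | par {m : ℕ} (g : Bound) (P : Instr τ loc sig a l (m + 1)) : Instr τ loc sig a l m

/-- Initial procedures: no access to `x`; change operations of supplementary instances can be
invoked, but not inside parallel branches. -/
inductive InitProc (τ loc : Schema) {I : Type} (sig : I → OpSig) (a : ℕ) : Type
  | instr (P : Instr τ loc sig a 0 0) : InitProc τ loc sig a
  | invoke (i : I) (c : (sig i).Chg)
      (y : Fin ((sig i).chgAr c) → Expr τ loc sig a 0 .term 0) : InitProc τ loc sig a
  | seq (P Q : InitProc τ loc sig a) : InitProc τ loc sig a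
  | ite (c : Expr τ loc sig a 0 .cond 0) (P Q : InitProc τ loc sig a) : InitProc τ loc sig a

/-- Main procedures: every execution path ends with a return statement of the kind `κ`. -/
inductive MainProc (τ loc : Schema) {I : Type} (sig : I → OpSig) (a l : ℕ) (κ : Kind) : Type
  | ret (e : Expr τ loc sig a l κ 0) : MainProc τ loc sig a l κ
  | seq (P : Instr τ loc sig a l 0) (Q : MainProc τ loc sig a l κ) : MainProc τ loc sig a l κ
  | ite (c : Expr τ loc sig a l .cond 0) (P Q : MainProc τ loc sig a l κ) :
      MainProc τ loc sig a l κ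

/-- The values of the local symbols, together with the sets of locations assigned so far. -/
structure LState (loc : Schema) (n : ℕ) extends Str loc n where
  wRel : (R : loc.Rel) → Set (Fin (loc.relAr R) → Fin n)
  wFn : (f : loc.Fn) → Set (Fin (loc.fnAr f) → Fin n)

/-- Nothing is assigned. -/
def LState.nil (loc : Schema) (n : ℕ) : LState loc n where
  rel := fun _ _ => False
  fn := fun _ _ => none
  wRel := fun _ => ∅
  wFn := fun _ => ∅

/-- The same values, with no location recorded as assigned. -/
def LState.fresh {loc : Schema} {n : ℕ} (L : LState loc n) : LState loc n :=
  { L with wRel := fun _ => ∅, wFn := fun _ => ∅ }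

open scoped Classical in
/-- Assignment of a Boolean value. -/
noncomputable def LState.setRel {loc : Schema} {n : ℕ} (L : LState loc n) (R : loc.Rel)
    (b : Fin (loc.relAr R) → Fin n) (v : Prop) : LState loc n where
  rel := fun R' b' =>
    if (⟨R', b'⟩ : (R : loc.Rel) × (Fin (loc.relAr R) → Fin n)) = ⟨R, b⟩ then v else L.rel R' b'
  fn := L.fn
  wRel := fun R' => {b' | b' ∈ L.wRel R' ∨
    (⟨R', b'⟩ : (R : loc.Rel) × (Fin (loc.relAr R) → Fin n)) = ⟨R, b⟩}
  wFn := L.wFn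

open scoped Classical in
/-- Assignment of a function value. -/
noncomputable def LState.setFn {loc : Schema} {n : ℕ} (L : LState loc n) (f : loc.Fn)
    (b : Fin (loc.fnAr f) → Fin n) (v : Option (Fin n)) : LState loc n where
  rel := L.rel
  fn := fun f' b' =>
    if (⟨f', b'⟩ : (f : loc.Fn) × (Fin (loc.fnAr f) → Fin n)) = ⟨f, b⟩ then v else L.fn f' b'
  wRel := L.wRel
  wFn := fun f' => {b' | b' ∈ L.wFn f' ∨
    (⟨f', b'⟩ : (f : loc.Fn) × (Fin (loc.fnAr f) → Fin n)) = ⟨f, b⟩}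

open scoped Classical in
/-- The result of a parallel branch over all `z` with `S z`, where `B z` is the outcome of the branch
for `z`: a location assigned in some branch gets its value there, all others keep their value. -/
noncomputable def LState.merge {loc : Schema} {n : ℕ} (L : LState loc n) (S : Fin n → Prop)
    (B : Fin n → LState loc n) : LState loc n where
  rel := fun R b => (∃ z, S z ∧ b ∈ (B z).wRel R ∧ (B z).rel R b) ∨
    ((¬ ∃ z, S z ∧ b ∈ (B z).wRel R) ∧ L.rel R b)
  fn := fun f b => if h : ∃ z, S z ∧ b ∈ (B z).wFn f then (B h.choose).fn f b else L.fn f b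
  wRel := fun R => {b | b ∈ L.wRel R ∨ ∃ z, S z ∧ b ∈ (B z).wRel R}
  wFn := fun f => {b | b ∈ L.wFn f ∨ ∃ z, S z ∧ b ∈ (B z).wFn f}

/-- Concurrent writes of the branches agree. -/
def LState.Agree {loc : Schema} {n : ℕ} (S : Fin n → Prop) (B : Fin n → LState loc n) : Prop :=
  ∀ z z', S z → S z' →
    (∀ R b, b ∈ (B z).wRel R → b ∈ (B z').wRel R → ((B z).rel R b ↔ (B z').rel R b)) ∧
    (∀ f b, b ∈ (B z).wFn f → b ∈ (B z').wFn f → (B z).fn f b = (B z').fn f b)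

section Procedures

variable {τ loc : Schema} {I : Type} {sig : I → OpSig} {a l n : ℕ} {M : (i : I) → Machine (sig i) n}

open scoped Classical in
/-- The effect of an instruction. The branches of a parallel branch run independently of each other
from the same state. -/
noncomputable def Instr.exec (E : Env τ M a l) :
    {m : ℕ} → Instr τ loc sig a l m → (Fin m → Fin n) → LState loc n → LState loc n
  | _, .skip, _, L => L
  | _, .seq P Q, z, L => Q.exec E z (P.exec E z L)
  | _, .setFn f y t _, z, L =>
      match tuple fun j => (y j).eval E L.toStr z with
      | some b => L.setFn f b (t.eval E L.toStr z)
      | none => L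
  | _, .setRel R y c _, z, L =>
      match tuple fun j => (y j).eval E L.toStr z with
      | some b => L.setRel R b (c.eval E L.toStr z)
      | none => L
  | _, .ite c P Q, z, L => if c.eval E L.toStr z then P.exec E z L else Q.exec E z L
  | _, .par g P, z, L =>
      L.merge (fun b => (b : ℕ) ≤ g.fn n) (fun b => P.exec E (Fin.snoc z b) L.fresh)

/-- The side conditions of the syntax are met in the execution of an instruction. -/
def Instr.Ok (E : Env τ M a l) :
    {m : ℕ} → Instr τ loc sig a l m → (Fin m → Fin n) → LState loc n → Prop
  | _, .skip, _, _ => True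
  | _, .seq P Q, z, L => P.Ok E z L ∧ Q.Ok E z (P.exec E z L)
  | _, .setFn _ y t _, z, L => (∀ j, (y j).Ok E L.toStr z) ∧ t.Ok E L.toStr z
  | _, .setRel _ y c _, z, L => (∀ j, (y j).Ok E L.toStr z) ∧ c.Ok E L.toStr z
  | _, .ite c P Q, z, L => c.Ok E L.toStr z ∧ (c.eval E L.toStr z → P.Ok E z L) ∧
      (¬ c.eval E L.toStr z → Q.Ok E z L)
  | _, .par g P, z, L =>
      (∀ b : Fin n, (b : ℕ) ≤ g.fn n → P.Ok E (Fin.snoc z b) L.fresh) ∧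
      LState.Agree (fun b => (b : ℕ) ≤ g.fn n) (fun b => P.exec E (Fin.snoc z b) L.fresh)

/-- The work of an instruction. -/
def Instr.work (M : (i : I) → Machine (sig i) n) : {m : ℕ} → Instr τ loc sig a l m → ℕ
  | _, .skip => 1
  | _, .seq P Q => max (P.work M) (Q.work M)
  | _, .setFn _ y t _ => max (t.work M) (Finset.univ.sup fun j => (y j).work M)
  | _, .setRel _ y c _ => max (c.work M) (Finset.univ.sup fun j => (y j).work M)
  | _, .ite c P Q => max (c.work M) (max (P.work M) (Q.work M))
  | _, .par g P => (g.fn n + 1) * P.work M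

open scoped Classical in
/-- The effect of an initial procedure on the local symbols and on the supplementary instances. -/
noncomputable def InitProc.exec (aux : Str τ n) (p : Fin a → Fin n) :
    InitProc τ loc sig a → LState loc n × ((i : I) → (M i).State) →
      LState loc n × ((i : I) → (M i).State)
  | .instr P, s => (P.exec (⟨aux, s.2, p, Fin.elim0⟩ : Env τ M a 0) Fin.elim0 s.1, s.2)
  | .invoke i c y, s =>
      match tuple fun j =>
        (y j).eval (⟨aux, s.2, p, Fin.elim0⟩ : Env τ M a 0) s.1.toStr Fin.elim0 with
      | some b => (s.1, Function.update s.2 i ((M i).chg c b (s.2 i)))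
      | none => s
  | .seq P Q, s => Q.exec aux p (P.exec aux p s)
  | .ite c P Q, s =>
      if c.eval (⟨aux, s.2, p, Fin.elim0⟩ : Env τ M a 0) s.1.toStr Fin.elim0 then P.exec aux p s
      else Q.exec aux p s

/-- The side conditions of the syntax are met in the execution of an initial procedure. -/
def InitProc.Ok (aux : Str τ n) (p : Fin a → Fin n) :
    InitProc τ loc sig a → LState loc n × ((i : I) → (M i).State) → Prop
  | .instr P, s => P.Ok (⟨aux, s.2, p, Fin.elim0⟩ : Env τ M a 0) Fin.elim0 s.1
  | .invoke i c y, s =>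
      (∀ j, (y j).Ok (⟨aux, s.2, p, Fin.elim0⟩ : Env τ M a 0) s.1.toStr Fin.elim0) ∧
      ∀ b, (tuple fun j =>
          (y j).eval (⟨aux, s.2, p, Fin.elim0⟩ : Env τ M a 0) s.1.toStr Fin.elim0) = some b →
        (M i).chgOk c b (s.2 i)
  | .seq P Q, s => P.Ok aux p s ∧ Q.Ok aux p (P.exec aux p s)
  | .ite c P Q, s =>
      c.Ok (⟨aux, s.2, p, Fin.elim0⟩ : Env τ M a 0) s.1.toStr Fin.elim0 ∧
      (c.eval (⟨aux, s.2, p, Fin.elim0⟩ : Env τ M a 0) s.1.toStr Fin.elim0 → P.Ok aux p s) ∧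
      (¬ c.eval (⟨aux, s.2, p, Fin.elim0⟩ : Env τ M a 0) s.1.toStr Fin.elim0 → Q.Ok aux p s)

/-- The work of an initial procedure. -/
def InitProc.work (M : (i : I) → Machine (sig i) n) : InitProc τ loc sig a → ℕ
  | .instr P => P.work M
  | .invoke i c y => max ((M i).chgWork c) (Finset.univ.sup fun j => (y j).work M)
  | .seq P Q => max (P.work M) (Q.work M)
  | .ite c P Q => max (c.work M) (max (P.work M) (Q.work M))

/-- The procedure contains an invocation of a change operation of the instance `i`. -/
def InitProc.Invokes (i : I) : InitProc τ loc sig a → Prop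
  | .instr _ => False
  | .invoke i' _ _ => i' = i
  | .seq P Q => P.Invokes i ∨ Q.Invokes i
  | .ite _ P Q => P.Invokes i ∨ Q.Invokes i

open scoped Classical in
/-- The value returned by a main procedure. -/
noncomputable def MainProc.run {κ : Kind} (E : Env τ M a l) :
    MainProc τ loc sig a l κ → LState loc n → Val n κ
  | .ret e, L => e.eval E L.toStr Fin.elim0
  | .seq P Q, L => Q.run E (P.exec E Fin.elim0 L)
  | .ite c P Q, L => if c.eval E L.toStr Fin.elim0 then P.run E L else Q.run E L

/-- The side conditions of the syntax are met in the execution of a main procedure. -/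
def MainProc.Ok {κ : Kind} (E : Env τ M a l) : MainProc τ loc sig a l κ → LState loc n → Prop
  | .ret e, L => e.Ok E L.toStr Fin.elim0
  | .seq P Q, L => P.Ok E Fin.elim0 L ∧ Q.Ok E (P.exec E Fin.elim0 L)
  | .ite c P Q, L => c.Ok E L.toStr Fin.elim0 ∧
      (c.eval E L.toStr Fin.elim0 → P.Ok E L) ∧ (¬ c.eval E L.toStr Fin.elim0 → Q.Ok E L)

/-- The work of a main procedure. -/
def MainProc.work {κ : Kind} (M : (i : I) → Machine (sig i) n) : MainProc τ loc sig a l κ → ℕ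
  | .ret e => e.work M
  | .seq P Q => max (P.work M) (Q.work M)
  | .ite c P Q => max (c.work M) (max (P.work M) (Q.work M))

end Procedures

/-! ### Rules -/

/-- No supplementary instances. -/
def noSig : Empty → OpSig := Empty.elim

/-- The update rule `on change δ(p) with init, update S at (t_1, …, t_k) for all x_i ≤ g_i(n),
by main`, for a symbol `S` of arity `ar` and an operation `δ` of arity `a`. The terms `t_i` are terms
over the auxiliary schema. -/
structure UpdateRule (τ : Schema) {I : Type} (sig : I → OpSig) (a : ℕ) (κ : Kind) (ar : ℕ) where
  loc : Schema
  init : InitProc τ loc sig a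
  l : ℕ
  bound : Fin l → Bound
  head : Fin ar → Expr τ Schema.nil noSig a l .term 0
  main : MainProc τ loc sig a l κ

namespace UpdateRule

variable {τ : Schema} {I : Type} {sig : I → OpSig} {a n ar : ℕ} {κ : Kind}
  {M : (i : I) → Machine (sig i) n}

/-- The outcome of the initial procedure. -/
noncomputable def after (r : UpdateRule τ sig a κ ar) (aux : Str τ n)
    (S : (i : I) → (M i).State) (p : Fin a → Fin n) :
    LState r.loc n × ((i : I) → (M i).State) :=
  r.init.exec aux p (LState.nil r.loc n, S)

/-- The constraint on `x`. -/
def Constraint (r : UpdateRule τ sig a κ ar) (x : Fin r.l → Fin n) : Prop :=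
  ∀ i, (x i : ℕ) ≤ (r.bound i).fn n

/-- The environment in which the terms of the head are evaluated. -/
def headEnv (r : UpdateRule τ sig a κ ar) (aux : Str τ n) (p : Fin a → Fin n)
    (x : Fin r.l → Fin n) : Env τ (fun i : Empty => (i.elim : Machine (noSig i) n)) a r.l :=
  ⟨aux, fun i => i.elim, p, x⟩

/-- The tuple at which the symbol is updated for `x`. -/
noncomputable def target (r : UpdateRule τ sig a κ ar) (aux : Str τ n) (p : Fin a → Fin n)
    (x : Fin r.l → Fin n) : Option (Fin ar → Fin n) :=
  tuple fun j => (r.head j).eval (r.headEnv aux p x) (LState.nil Schema.nil n).toStr Fin.elim0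

/-- The environment of the main procedure for `x`. -/
noncomputable def mainEnv (r : UpdateRule τ sig a κ ar) (aux : Str τ n)
    (S : (i : I) → (M i).State) (p : Fin a → Fin n) (x : Fin r.l → Fin n) : Env τ M a r.l :=
  ⟨aux, (r.after aux S p).2, p, x⟩

/-- The value returned for `x`. -/
noncomputable def value (r : UpdateRule τ sig a κ ar) (aux : Str τ n)
    (S : (i : I) → (M i).State) (p : Fin a → Fin n) (x : Fin r.l → Fin n) : Val n κ :=
  r.main.run (r.mainEnv aux S p x) (r.after aux S p).1

/-- The side conditions of the syntax are met in the evaluation of the rule, and concurrent updates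
of the same tuple agree when `κ` is the kind of terms. -/
def Ok (r : UpdateRule τ sig a κ ar) (aux : Str τ n) (S : (i : I) → (M i).State)
    (p : Fin a → Fin n) : Prop :=
  r.init.Ok aux p (LState.nil r.loc n, S) ∧
  (∀ x, r.Constraint x →
    (∀ j, (r.head j).Ok (r.headEnv aux p x) (LState.nil Schema.nil n).toStr Fin.elim0) ∧
    r.main.Ok (r.mainEnv aux S p x) (r.after aux S p).1) ∧
  (κ = .term → ∀ x x' b, r.Constraint x → r.Constraint x' → r.target aux p x = some b →
    r.target aux p x' = some b → r.value aux S p x = r.value aux S p x')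

/-- The work of an update rule. -/
def work (M : (i : I) → Machine (sig i) n) (r : UpdateRule τ sig a κ ar) : ℕ :=
  max (r.init.work M) ((∏ i, ((r.bound i).fn n + 1)) *
    max (r.main.work M) (Finset.univ.sup fun j =>
      (r.head j).work (fun i : Empty => (i.elim : Machine (noSig i) n))))

end UpdateRule

/-- The new value of a relation. -/
noncomputable def UpdateRule.newRel {τ : Schema} {I : Type} {sig : I → OpSig} {a n ar : ℕ}
    {M : (i : I) → Machine (sig i) n} (r : UpdateRule τ sig a .cond ar) (aux : Str τ n)
    (S : (i : I) → (M i).State) (p : Fin a → Fin n) (old : (Fin ar → Fin n) → Prop)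
    (b : Fin ar → Fin n) : Prop :=
  (∃ x, r.Constraint x ∧ r.target aux p x = some b ∧ r.value aux S p x) ∨
  (old b ∧ ¬ ∃ x, r.Constraint x ∧ r.target aux p x = some b)

open scoped Classical in
/-- The new value of a function. -/
noncomputable def UpdateRule.newFn {τ : Schema} {I : Type} {sig : I → OpSig} {a n ar : ℕ}
    {M : (i : I) → Machine (sig i) n} (r : UpdateRule τ sig a .term ar) (aux : Str τ n)
    (S : (i : I) → (M i).State) (p : Fin a → Fin n) (old : (Fin ar → Fin n) → Option (Fin n))
    (b : Fin ar → Fin n) : Option (Fin n) :=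
  if h : ∃ x, r.Constraint x ∧ r.target aux p x = some b then r.value aux S p h.choose else old b

/-- A query rule: a procedure without change invocations and without variables `x`. -/
structure QueryRule (τ : Schema) {I : Type} (sig : I → OpSig) (a : ℕ) (κ : Kind) where
  loc : Schema
  main : MainProc τ loc sig a 0 κ

/-- The result of a query rule. -/
noncomputable def QueryRule.value {τ : Schema} {I : Type} {sig : I → OpSig} {a n : ℕ} {κ : Kind}
    {M : (i : I) → Machine (sig i) n} (r : QueryRule τ sig a κ) (aux : Str τ n)
    (S : (i : I) → (M i).State) (p : Fin a → Fin n) : Val n κ :=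
  r.main.run (⟨aux, S, p, Fin.elim0⟩ : Env τ M a 0) (LState.nil r.loc n)

/-- The side conditions of the syntax are met in the evaluation of a query rule. -/
def QueryRule.Ok {τ : Schema} {I : Type} {sig : I → OpSig} {a n : ℕ} {κ : Kind}
    {M : (i : I) → Machine (sig i) n} (r : QueryRule τ sig a κ) (aux : Str τ n)
    (S : (i : I) → (M i).State) (p : Fin a → Fin n) : Prop :=
  r.main.Ok (⟨aux, S, p, Fin.elim0⟩ : Env τ M a 0) (LState.nil r.loc n)

/-! ### Dynamic programs -/

/-- The rules of a dynamic program with operations `σ`, auxiliary schema `τ` and supplementary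
instances `i : I` with operations `sig i`. A symbol without update rule for an operation is not
changed by that operation. -/
structure Rules (τ : Schema) {I : Type} (sig : I → OpSig) (σ : OpSig) where
  /-- The first-order definition of the initial relations. As the initial input structure is empty,
  it uses arithmetic only. -/
  relStart : (R : τ.Rel) → arith.Formula (Fin (τ.relAr R))
  /-- The first-order definition of the graphs of the initial functions. -/
  fnStart : (f : τ.Fn) → arith.Formula (Fin (τ.fnAr f + 1))
  updRel : (c : σ.Chg) → (R : τ.Rel) → Option (UpdateRule τ sig (σ.chgAr c) .cond (τ.relAr R))
  updFn : (c : σ.Chg) → (f : τ.Fn) → Option (UpdateRule τ sig (σ.chgAr c) .term (τ.fnAr f))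
  rq : (q : σ.RQ) → QueryRule τ sig (σ.rqAr q) .cond
  fq : (q : σ.FQ) → QueryRule τ sig (σ.fqAr q) .term

namespace Rules

variable {τ : Schema} {I : Type} {sig : I → OpSig} {σ : OpSig}

/-- The rule of the symbol `s` for the change operation `c` invokes a change operation of `i`. -/
def Invokes (D : Rules τ sig σ) (c : σ.Chg) (i : I) : τ.Rel ⊕ τ.Fn → Prop
  | .inl R => ∃ r, D.updRel c R = some r ∧ r.init.Invokes i
  | .inr f => ∃ r, D.updFn c f = some r ∧ r.init.Invokes i

/-- For each change operation and each supplementary instance, at most one update rule invokes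
change operations of this instance. -/
def Once (D : Rules τ sig σ) : Prop :=
  ∀ c i s s', D.Invokes c i s → D.Invokes c i s' → s = s'

open scoped Classical in
/-- The initial auxiliary structure. -/
noncomputable def startStr (D : Rules τ sig σ) (n : ℕ) : Str τ n where
  rel := fun R b => (D.relStart R).Realize b
  fn := fun f b =>
    if h : ∃! v : Fin n, (D.fnStart f).Realize (Fin.snoc b v : Fin (τ.fnAr f + 1) → Fin n)
    then some h.choose else none

variable {n : ℕ} {M : (i : I) → Machine (sig i) n}

/-- The auxiliary structure after a change. All rules are evaluated on the old state. -/
noncomputable def newAux (D : Rules τ sig σ) (c : σ.Chg) (p : Fin (σ.chgAr c) → Fin n)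
    (aux : Str τ n) (S : (i : I) → (M i).State) : Str τ n where
  rel := fun R =>
    match D.updRel c R with
    | some r => r.newRel aux S p (aux.rel R)
    | none => aux.rel R
  fn := fun f =>
    match D.updFn c f with
    | some r => r.newFn aux S p (aux.fn f)
    | none => aux.fn f

/-- The states of the supplementary instances after the initial procedure of the rule of `s`. -/
noncomputable def instAfter (D : Rules τ sig σ) (c : σ.Chg) (p : Fin (σ.chgAr c) → Fin n)
    (aux : Str τ n) (S : (i : I) → (M i).State) : τ.Rel ⊕ τ.Fn → (i : I) → (M i).State
  | .inl R =>
    match D.updRel c R with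
    | some r => (r.after aux S p).2
    | none => S
  | .inr f =>
    match D.updFn c f with
    | some r => (r.after aux S p).2
    | none => S

open scoped Classical in
/-- The states of the supplementary instances after a change: an instance is changed by the rule
that invokes its change operations. -/
noncomputable def newInst (D : Rules τ sig σ) (c : σ.Chg) (p : Fin (σ.chgAr c) → Fin n)
    (aux : Str τ n) (S : (i : I) → (M i).State) (i : I) : (M i).State :=
  if h : ∃ s, D.Invokes c i s then D.instAfter c p aux S h.choose i else S i

/-- A dynamic program on `[n]`, given its supplementary instances on `[n]`. -/
noncomputable def machine (D : Rules τ sig σ) (M : (i : I) → Machine (sig i) n) :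
    Machine σ n where
  State := Str τ n × ((i : I) → (M i).State)
  start := (D.startStr n, fun i => (M i).start)
  chg := fun c p s => (D.newAux c p s.1 s.2, D.newInst c p s.1 s.2)
  rq := fun q p s => (D.rq q).value s.1 s.2 p
  fq := fun q p s => (D.fq q).value s.1 s.2 p
  chgOk := fun c p s =>
    (∀ R r, D.updRel c R = some r → r.Ok s.1 s.2 p) ∧
    (∀ f r, D.updFn c f = some r → r.Ok s.1 s.2 p)
  rqOk := fun q p s => (D.rq q).Ok s.1 s.2 p
  fqOk := fun q p s => (D.fq q).Ok s.1 s.2 p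
  chgWork := fun c => max
    (Finset.univ.sup fun R => ((D.updRel c R).map fun r => r.work M).getD 0)
    (Finset.univ.sup fun f => ((D.updFn c f).map fun r => r.work M).getD 0)
  rqWork := fun q => (D.rq q).main.work M
  fqWork := fun q => (D.fq q).main.work M

end Rules

/-- Procedural-DynFO-programs with operations `σ`: an auxiliary schema, finitely many supplementary
instances of other such programs, and the rules. -/
inductive Program : OpSig → Type 1
  | mk {σ : OpSig} (τ : Schema) (I : Type) (finite : Finite I) (sig : I → OpSig)
      (sub : (i : I) → Program (sig i)) (rules : Rules τ sig σ) (once : rules.Once) : Program σ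

/-- The program on the domain `[n]`; supplementary instances have the same domain. -/
noncomputable def Program.machine (n : ℕ) : {σ : OpSig} → Program σ → Machine σ n
  | _, .mk _ _ _ _ sub rules _ => rules.machine fun i => (sub i).machine n

/-- The state reached from the start by a sequence of change operations. -/
def Machine.after {σ : OpSig} {n : ℕ} (M : Machine σ n) :
    List ((c : σ.Chg) × (Fin (σ.chgAr c) → Fin n)) → M.State :=
  List.foldl (fun s δ => M.chg δ.1 δ.2 s) M.start

/-- The data reached from the empty data by a sequence of change operations. -/
def DynProblem.after (Pi : DynProblem) (n : ℕ) :
    List ((c : Pi.sig.Chg) × (Fin (Pi.sig.chgAr c) → Fin n)) → Pi.Data n :=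
  List.foldl (fun d δ => Pi.chg δ.1 δ.2 d) (Pi.empty n)

/-- `P` is a dynamic program for the dynamic problem `Pi`: after every sequence of change operations
on every domain, all queries are answered correctly (and the side conditions of the syntax are met
in all evaluations). -/
def Program.IsFor (Pi : DynProblem) (P : Program Pi.sig) : Prop :=
  ∀ (n : ℕ) (α : List ((c : Pi.sig.Chg) × (Fin (Pi.sig.chgAr c) → Fin n))),
    (∀ q p, (P.machine n).rq q p ((P.machine n).after α) ↔ Pi.rq q p (Pi.after n α)) ∧
    (∀ q p, (P.machine n).fq q p ((P.machine n).after α) = Pi.fq q p (Pi.after n α)) ∧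
    (∀ c p, (P.machine n).chgOk c p ((P.machine n).after α)) ∧
    (∀ q p, (P.machine n).rqOk q p ((P.machine n).after α)) ∧
    (∀ q p, (P.machine n).fqOk q p ((P.machine n).after α))

/-- Every operation of the program has work `O(W(n))`. -/
def Program.HasWork {σ : OpSig} (P : Program σ) (W : ℕ → ℝ) : Prop :=
  (∀ c, (fun n : ℕ => ((P.machine n).chgWork c : ℝ)) =O[atTop] W) ∧
  (∀ q, (fun n : ℕ => ((P.machine n).rqWork q : ℝ)) =O[atTop] W) ∧
  (∀ q, (fun n : ℕ => ((P.machine n).fqWork q : ℝ)) =O[atTop] W)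

/-- `Pi` can be maintained in DynFO with `O(W(n))` work. -/
def MaintainableInDynFO (Pi : DynProblem) (W : ℕ → ℝ) : Prop :=
  ∃ P : Program Pi.sig, P.IsFor Pi ∧ P.HasWork W

/-! ### Membership in Dyck languages -/

/-- The word `w_0 ∘ ⋯ ∘ w_{n-1}` represented by a sequence over `A ∪ {ε}` (`none` is `ε`). -/
def wordOf {A : Type} {n : ℕ} (w : Fin n → Option A) : List A :=
  (List.ofFn w).reduceOption

open scoped Classical in
/-- The dynamic problem `Member(L)`. The change operation `some σ` is `set_σ(i)`, which sets `w_i` to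
`σ` if `w_i = ε`, and `none` is `reset(i)`, which sets `w_i` to `ε`. The only query is Boolean. -/
noncomputable def memberProblem {A : Type} [Fintype A] (L : Language A) : DynProblem where
  sig :=
    { Chg := Option A
      RQ := Unit
      FQ := Empty
      chgAr := fun _ => 1
      rqAr := fun _ => 0
      fqAr := fun _ => 0 }
  Data := fun n => Fin n → Option A
  empty := fun _ _ => none
  chg := fun c i w =>
    match c with
    | some σ => if w (i 0) = none then Function.update w (i 0) (some σ) else w
    | none => Function.update w (i 0) none
  rq := fun _ _ w => wordOf w ∈ L
  fq := fun q _ _ => q.elim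

/-- The parentheses of `k` types: `inl i` is the `i`-th opening one, `inr i` the `i`-th closing one. -/
abbrev Paren (k : ℕ) : Type := Fin k ⊕ Fin k

/-- Well-balanced strings of parentheses of `k` types. -/
inductive WellBalanced {k : ℕ} : List (Paren k) → Prop
  | nil : WellBalanced []
  | wrap (i : Fin k) {w : List (Paren k)} :
      WellBalanced w → WellBalanced (Sum.inl i :: (w ++ [Sum.inr i]))
  | append {v w : List (Paren k)} : WellBalanced v → WellBalanced w → WellBalanced (v ++ w)

/-- The Dyck language `D_k`. -/
def dyck (k : ℕ) : Language (Paren k) := {w | WellBalanced w}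

/-! ### Well-balanced strings and stacks -/

/-! The stack of open parentheses is kept in one function. Regard every negative position as an
opening parenthesis, so that the stack never runs empty, and let `T x` be the top of the stack
before position `x`, where a closing parenthesis pops the top whatever its type. The stack before
`x` is then `T x`, `T (T x)`, and so on. The word is balanced exactly if every closing parenthesis
`c` finds an opening one of its type at `T c` and every opening parenthesis is `T c` for some
closing `c` (`StackTop.wellBalanced_iff`).

A change at `p` affects `T x` only if `p < x` and `T x ≤ p`. Inserting a closing or deleting an
opening parenthesis replaces such a `T x` by `T (T x)` (`StackTop.down`). Inserting an opening or
deleting a closing one replaces it by the next higher element of one fixed stack, whose top is `p`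
or `T p` respectively (`StackTop.up`). This needs the inverse of `T` on that stack, which exists
because `T` is injective there (`StackTop.stack_injOn`). Apart from `p` itself, the nonnegative
members of the stack are the opening parentheses before `p` that are not `T c` for a closing `c < p`
(`StackTop.stack_top_iff`).

All this takes linear work. The auxiliary symbols are unary and every update rule has one variable
`x` and a body of constant work. Both the projection "some closing `c` has `T c = z`" and the
inverse of `T` are obtained by letting each `x` write at the location `T x` instead of searching for
each `z`. Within one operation all rules see the old state, whereas the rounds of this computation
depend on each other. Each round is therefore a change operation of a supplementary instance, and
the initial procedure of the main program invokes a bounded number of them in succession. Every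
operation has work at most `n + 1`, which is below the claimed bound. -/

/-- Reading the string with the given stack of open parentheses ends with the empty stack. -/
def Closes {k : ℕ} : List (Paren k) → List (Fin k) → Prop
  | [], st => st = []
  | .inl i :: l, st => Closes l (i :: st)
  | .inr i :: l, st => ∃ st', st = i :: st' ∧ Closes l st'

/-- A balanced prefix leaves the stack as it was. Quantifying over the continuation and the stack is
what lets the induction pass through `wrap` and `append`. -/
theorem WellBalanced.closes_append {k : ℕ} {v : List (Paren k)} (hv : WellBalanced v) :
    ∀ l st, Closes (v ++ l) st ↔ Closes l st := by
  induction hv with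
  | nil => intro l st; rfl
  | wrap i _ ih =>
    intro l st
    rw [List.cons_append, List.append_assoc, Closes, ih]
    simp [Closes]
  | append _ _ ih₁ ih₂ => intro l st; rw [List.append_assoc, ih₁, ih₂]

/-- This is the converse of cancelling an adjacent matching pair. It serves `Closes.wellBalanced`,
where a pop puts such a pair between the stack and the rest of the word. -/
theorem WellBalanced.insert_pair {k : ℕ} (i : Fin k) {l : List (Paren k)} (h : WellBalanced l) :
    ∀ u v, l = u ++ v → WellBalanced (u ++ .inl i :: .inr i :: v) := by
  induction h with
  | nil =>
    intro u v huv
    obtain ⟨rfl, rfl⟩ := List.append_eq_nil_iff.1 huv.symm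
    exact .wrap i .nil
  | @wrap j w hw ih =>
    intro u v huv
    rcases u with _ | ⟨a, u⟩
    · rw [List.nil_append] at huv
      rw [← huv]
      exact .append (v := [.inl i, .inr i]) (.wrap i .nil) (.wrap j hw)
    · rw [List.cons_append, List.cons.injEq] at huv
      obtain ⟨rfl, huv⟩ := huv
      rcases List.eq_nil_or_concat' v with rfl | ⟨v, b, rfl⟩
      · rw [List.append_nil] at huv
        rw [← huv]
        exact .append (v := .inl j :: (w ++ [.inr j])) (.wrap j hw) (.wrap i .nil)
      · rw [← List.append_assoc] at huv
        obtain ⟨huv, hb⟩ := List.append_inj' huv rfl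
        rw [List.singleton_inj.1 hb.symm]
        simpa using WellBalanced.wrap j (ih u v huv)
  | @append v₁ v₂ h₁ h₂ ih₁ ih₂ =>
    intro u v huv
    rcases List.append_eq_append_iff.1 huv with ⟨a, rfl, rfl⟩ | ⟨a, rfl, rfl⟩
    · simpa using WellBalanced.append h₁ (ih₂ a v rfl)
    · simpa using WellBalanced.append (ih₁ u a rfl) h₂

/-- The stack, written from bottom to top as opening parentheses, completes the remaining word on
the left. Reading an opening parenthesis only moves it across the border; reading a closing one is
undone by `WellBalanced.insert_pair`. -/
theorem Closes.wellBalanced {k : ℕ} {l : List (Paren k)} :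
    ∀ {st}, Closes l st → WellBalanced ((st.map Sum.inl).reverse ++ l) := by
  induction l with
  | nil => rintro st rfl; exact .nil
  | cons a l ih =>
    rcases a with i | i
    · intro st h
      simpa using ih (st := i :: st) h
    · rintro st ⟨st, rfl, h⟩
      simpa using (ih h).insert_pair i _ _ rfl

theorem wellBalanced_iff_closes {k : ℕ} (l : List (Paren k)) : WellBalanced l ↔ Closes l [] := by
  constructor
  · intro h
    have := (h.closes_append [] []).2 rfl
    rwa [List.append_nil] at this
  · intro h
    exact h.wellBalanced

/-! ### The top of the stack at every position -/

/-- `T x` is the position of the innermost open parenthesis before position `x`. Every negative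
position is regarded as carrying an opening parenthesis. -/
structure StackTop {k : ℕ} (w : ℤ → Option (Paren k)) (T : ℤ → ℤ) : Prop where
  virt : ∀ x ≤ 0, T x = x - 1
  eps : ∀ x ≥ 0, w x = none → T (x + 1) = T x
  opn : ∀ x ≥ 0, ∀ i, w x = some (.inl i) → T (x + 1) = x
  cls : ∀ x ≥ 0, ∀ i, w x = some (.inr i) → T (x + 1) = T (T x)

namespace StackTop

variable {k : ℕ} {w : ℤ → Option (Paren k)} {T : ℤ → ℤ}

theorem empty : StackTop (fun _ => none : ℤ → Option (Paren k)) (fun x => min (x - 1) (-1)) where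
  virt := fun x hx => by omega
  eps := fun x hx _ => by omega
  opn := fun _ _ _ h => by simp at h
  cls := fun _ _ _ h => by simp at h

/-- Each position from `0` on pops at most one element, so at most `x` virtual parentheses are gone
before `x ≥ 0` and the top is at least `-1 - x`. For `x ≤ 0` the minimum is `x - 1`, the value
prescribed there. -/
theorem bounds (hT : StackTop w T) (m : ℕ) : ∀ x ≤ (m : ℤ), T x < x ∧ min (x - 1) (-1 - x) ≤ T x := by
  induction m with
  | zero => intro x hx; rw [hT.virt x (by simpa using hx)]; omega
  | succ m ih =>
    intro x hx
    by_cases hxm : x ≤ m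
    · exact ih x hxm
    obtain rfl : x = m + 1 := by push_cast at hx; omega
    have h₀ := ih m le_rfl
    rcases hm : w m with _ | i | i
    · rw [hT.eps m (by omega) hm]; omega
    · rw [hT.opn m (by omega) i hm]; omega
    · rw [hT.cls m (by omega) i hm]
      have h₁ := ih (T m) (by omega)
      by_cases h : T m ≤ 0
      · rw [hT.virt _ h]; omega
      · omega

theorem lt (hT : StackTop w T) (x : ℤ) : T x < x :=
  (hT.bounds x.toNat x (Int.self_le_toNat x)).1

theorem ge (hT : StackTop w T) {x : ℤ} (hx : 0 ≤ x) : -1 - x ≤ T x := by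
  have := (hT.bounds x.toNat x (Int.self_le_toNat x)).2
  omega

/-! ### How the tops change when one letter changes -/

/-- The stack loses its element at the height of position `p`. -/
theorem down (hT : StackTop w T) {w' : ℤ → Option (Paren k)} {p : ℤ} (hp : 0 ≤ p)
    (hw : ∀ x ≠ p, w' x = w x)
    (h : (w p = none ∧ ∃ i, w' p = some (.inr i)) ∨ (w' p = none ∧ ∃ i, w p = some (.inl i))) :
    StackTop w' (fun x => if p < x ∧ T x ≤ p then T (T x) else T x) := by
  have key := hT.lt
  refine ⟨fun x hx => ?_, fun x hx hwx => ?_, fun x hx i hwx => ?_, fun x hx i hwx => ?_⟩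
  · rw [if_neg (by omega), hT.virt x hx]
  · rcases eq_or_ne x p with rfl | hne
    · rcases h with ⟨_, i, h⟩ | ⟨_, i, h⟩
      · simp [h] at hwx
      · simp [hT.opn x hx i h]
    · rw [hw x hne] at hwx
      rw [hT.eps x hx hwx]
      refine if_congr ?_ rfl rfl
      have := key x
      omega
  · rcases eq_or_ne x p with rfl | hne
    · rcases h with ⟨_, j, h⟩ | ⟨h, _⟩ <;> simp [h] at hwx
    · rw [hw x hne] at hwx
      rw [hT.opn x hx i hwx, if_neg (by omega)]
  · have h₁ := key x
    have h₂ := key (T x)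
    rcases eq_or_ne x p with rfl | hne
    · rcases h with ⟨h, _⟩ | ⟨h, _⟩
      · rw [hT.eps x hx h, if_pos (by omega), if_neg (c := x < x ∧ _) (by omega), if_neg (by omega)]
      · simp [h] at hwx
    · rw [hw x hne] at hwx
      rw [hT.cls x hx i hwx]
      -- If the top at `x` has changed, the new top `T (T x)` lies before `p`, where nothing has
      -- changed, so popping once more gives `T (T (T x))`. Otherwise both sides make the same case
      -- distinction at `T x`.
      by_cases hxp : p < x ∧ T x ≤ p
      · rw [if_pos (by omega), if_pos hxp, if_neg (by omega)]
      · rw [if_neg (c := p < x ∧ T x ≤ p) hxp]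
        refine if_congr ?_ rfl rfl
        omega

/-- The stack at every position after `p` gets an additional element: `c` maps every element of the
stack `Q` that is not the top one to the next higher one. -/
theorem up (hT : StackTop w T) {w' : ℤ → Option (Paren k)} {p : ℤ} (hp : 0 ≤ p)
    (hw : ∀ x ≠ p, w' x = w x) {Q : ℤ → Prop} {c : ℤ → ℤ} (hQ : ∀ q, Q q → Q (T q))
    (hQp : ∀ q, Q q → q ≤ p) (hc : ∀ q, Q q → c (T q) = q)
    (h : (w p = none ∧ (∃ i, w' p = some (.inl i)) ∧ Q p) ∨
      (w' p = none ∧ (∃ i, w p = some (.inr i)) ∧ Q (T p))) :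
    (∀ x, p < x → T x ≤ p → ∃ q, Q q ∧ T x = T q) ∧
    StackTop w' (fun x => if p < x ∧ T x ≤ p then c (T x) else T x) := by
  have key := hT.lt
  -- Induction on the distance from `p`: the part of a later stack that lies at or before `p` is
  -- what remains of `Q` below its top. So such a top is always the image under `T` of a member of
  -- `Q`.
  have hmem : ∀ m : ℕ, ∀ x, p < x → x ≤ p + m → T x ≤ p → ∃ q, Q q ∧ T x = T q := by
    intro m
    induction m with
    | zero => intro x h₁ h₂; push_cast at h₂; omega
    | succ m ih =>
      intro x h₁ h₂ h₃
      obtain ⟨x, rfl⟩ : ∃ y, x = y + 1 := ⟨x - 1, by omega⟩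
      push_cast at h₂
      rcases eq_or_ne x p with rfl | hne
      · rcases h with ⟨h, _, hq⟩ | ⟨_, ⟨i, h⟩, hq⟩
        · exact ⟨x, hq, hT.eps x hp h⟩
        · exact ⟨T x, hq, hT.cls x hp i h⟩
      · have hx : p < x := by omega
        rcases hwx : w x with _ | i | i
        · rw [hT.eps x (by omega) hwx] at h₃ ⊢
          exact ih x hx (by omega) h₃
        · rw [hT.opn x (by omega) i hwx] at h₃
          omega
        · rw [hT.cls x (by omega) i hwx] at h₃ ⊢
          have := key x
          by_cases hTx : T x ≤ p
          · obtain ⟨q, hq, e⟩ := ih x hx (by omega) hTx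
            exact ⟨T q, hQ q hq, by rw [e]⟩
          · exact ih (T x) (by omega) (by omega) h₃
  have hmem : ∀ x, p < x → T x ≤ p → ∃ q, Q q ∧ T x = T q := fun x hx =>
    hmem (x - p).toNat x hx (by omega)
  refine ⟨hmem, fun x hx => ?_, fun x hx hwx => ?_, fun x hx i hwx => ?_, fun x hx i hwx => ?_⟩
  · rw [if_neg (by omega), hT.virt x hx]
  · have := key x
    rcases eq_or_ne x p with rfl | hne
    · rcases h with ⟨_, ⟨i, h⟩, _⟩ | ⟨_, ⟨i, h⟩, hq⟩
      · simp [h] at hwx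
      · have := key (T x)
        rw [hT.cls x hx i h, if_pos (by omega), if_neg (by omega), hc _ hq]
    · rw [hw x hne] at hwx
      rw [hT.eps x hx hwx]
      refine if_congr ?_ rfl rfl
      omega
  · have := key x
    rcases eq_or_ne x p with rfl | hne
    · rcases h with ⟨h, _, hq⟩ | ⟨h, _⟩
      · rw [hT.eps x hx h, if_pos (by omega), hc _ hq]
      · simp [h] at hwx
    · rw [hw x hne] at hwx
      rw [hT.opn x hx i hwx, if_neg (by omega)]
  · have h₁ := key x
    have h₂ := key (T x)
    rcases eq_or_ne x p with rfl | hne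
    · rcases h with ⟨_, ⟨i, h⟩, _⟩ | ⟨h, _⟩ <;> simp [h] at hwx
    · rw [hw x hne] at hwx
      rw [hT.cls x hx i hwx]
      by_cases hxp : p < x ∧ T x ≤ p
      -- With `T x = T q` the new top at `x` is `q ≤ p`, where the tops are unchanged. Popping it
      -- gives `T q`, and this is also `c (T (T q))` since `T q` belongs to `Q`.
      · obtain ⟨q, hq, e⟩ := hmem x hxp.1 hxp.2
        have := hQp q hq
        rw [if_pos (by omega), if_pos hxp, e, hc _ hq, if_neg (by omega), hc _ (hQ q hq)]
      · rw [if_neg (c := p < x ∧ T x ≤ p) hxp]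
        refine if_congr ?_ rfl rfl
        omega

/-! ### A stack as the set of iterates of `T` -/

/-- The stack consisting of the position `y` and everything below it. -/
def Stack (T : ℤ → ℤ) (y z : ℤ) : Prop := ∃ i : ℕ, T^[i] y = z

theorem stack_self (y : ℤ) : Stack T y y := ⟨0, rfl⟩

theorem stack_iff (y z : ℤ) : Stack T y z ↔ z = y ∨ Stack T (T y) z := by
  constructor
  · rintro ⟨_ | i, h⟩
    · exact .inl h.symm
    · exact .inr ⟨i, h⟩
  · rintro (rfl | ⟨i, h⟩)
    · exact stack_self z
    · exact ⟨i + 1, h⟩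

theorem Stack.top {y z : ℤ} (h : Stack T y z) : Stack T y (T z) := by
  obtain ⟨i, rfl⟩ := h
  exact ⟨i + 1, Function.iterate_succ_apply' T i y⟩

theorem stack_le (hT : StackTop w T) {y z : ℤ} (h : Stack T y z) : z ≤ y := by
  obtain ⟨i, rfl⟩ := h
  induction i with
  | zero => exact le_rfl
  | succ i ih =>
    rw [Function.iterate_succ_apply']
    exact (hT.lt _).le.trans ih

/-- `T` strictly decreases along the stack, so two different members cannot have the same next lower
element. Hence "next higher element" is a partial function, and the concurrent writes that compute
it agree. -/
theorem stack_injOn (hT : StackTop w T) {y z z' : ℤ} (h : Stack T y z) (h' : Stack T y z')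
    (e : T z = T z') : z = z' := by
  have main : ∀ i j : ℕ, i < j → T (T^[i] y) ≠ T (T^[j] y) := by
    intro i j hij e
    have h₁ : Stack T (T (T^[i] y)) (T^[j] y) := ⟨j - (i + 1), by
      rw [← Function.iterate_succ_apply' T i, ← Function.iterate_add_apply]
      congr 2
      omega⟩
    have h₂ := hT.stack_le h₁
    rw [e] at h₂
    exact absurd (hT.lt (T^[j] y)) (not_lt.2 h₂)
  obtain ⟨i, rfl⟩ := h
  obtain ⟨j, rfl⟩ := h'
  rcases lt_trichotomy i j with hij | rfl | hij
  · exact absurd e (main i j hij)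
  · rfl
  · exact absurd e.symm (main j i hij)

/-- The elements of the stack before position `p` are the opening parentheses that are not closed
before `p`. -/
theorem stack_top_iff (hT : StackTop w T) (p : ℕ) {z : ℤ} (hz : 0 ≤ z) :
    Stack T (T p) z ↔ z < p ∧ (∃ i, w z = some (.inl i)) ∧
      ¬ ∃ c : ℤ, 0 ≤ c ∧ c < p ∧ (∃ i, w c = some (.inr i)) ∧ T c = z := by
  induction p with
  | zero =>
    constructor
    · intro h
      have h₁ := hT.stack_le h
      have h₂ := hT.lt 0
      push_cast at h₁
      omega
    · rintro ⟨h, _⟩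
      push_cast at h
      omega
  | succ p ih =>
    have hp := hT.lt p
    push_cast
    rcases hwp : w p with _ | i | i
    · rw [hT.eps p (by omega) hwp, ih]
      constructor
      · rintro ⟨h₁, h₂, h₃⟩
        refine ⟨by omega, h₂, fun ⟨c, hc₀, hc, ⟨i, hi⟩, e⟩ => h₃ ⟨c, hc₀, ?_, ⟨i, hi⟩, e⟩⟩
        rcases eq_or_ne c p with rfl | hne
        · simp [hwp] at hi
        · omega
      · rintro ⟨h₁, ⟨i, h₂⟩, h₃⟩
        refine ⟨?_, ⟨i, h₂⟩, fun ⟨c, hc₀, hc, hi⟩ => h₃ ⟨c, hc₀, by omega, hi⟩⟩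
        rcases eq_or_ne z p with rfl | hne
        · simp [hwp] at h₂
        · omega
    · rw [hT.opn p (by omega) i hwp, stack_iff, ih]
      constructor
      · rintro (rfl | ⟨h₁, h₂, h₃⟩)
        · refine ⟨by omega, ⟨i, hwp⟩, fun ⟨c, _, hc, _, e⟩ => ?_⟩
          have := hT.lt c
          omega
        · refine ⟨by omega, h₂, fun ⟨c, hc₀, hc, ⟨i, hi⟩, e⟩ => h₃ ⟨c, hc₀, ?_, ⟨i, hi⟩, e⟩⟩
          rcases eq_or_ne c p with rfl | hne
          · simp [hwp] at hi
          · omega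
      · rintro ⟨h₁, h₂, h₃⟩
        rcases eq_or_ne z p with rfl | hne
        · exact .inl rfl
        · exact .inr ⟨by omega, h₂, fun ⟨c, hc₀, hc, hi⟩ => h₃ ⟨c, hc₀, by omega, hi⟩⟩
    -- A closing parenthesis at `p` pops exactly `T p`, which is also the one element that `p` newly
    -- closes.
    · have : Stack T (T (T p)) z ↔ Stack T (T p) z ∧ z ≠ T p := by
        rw [stack_iff (T p)]
        constructor
        · intro h
          refine ⟨.inr h, ?_⟩
          have h₁ := hT.stack_le h
          have h₂ := hT.lt (T p)
          omega
        · rintro ⟨h | h, h'⟩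
          · exact absurd h h'
          · exact h
      rw [hT.cls p (by omega) i hwp, this, ih]
      constructor
      · rintro ⟨⟨h₁, h₂, h₃⟩, hne⟩
        refine ⟨by omega, h₂, fun ⟨c, hc₀, hc, hi, e⟩ => h₃ ⟨c, hc₀, ?_, hi, e⟩⟩
        rcases eq_or_ne c p with rfl | hne
        · exact absurd e.symm hne
        · omega
      · rintro ⟨h₁, ⟨j, h₂⟩, h₃⟩
        refine ⟨⟨?_, ⟨j, h₂⟩, fun ⟨c, hc₀, hc, hi⟩ => h₃ ⟨c, hc₀, by omega, hi⟩⟩, ?_⟩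
        · rcases eq_or_ne z p with rfl | hne
          · simp [hwp] at h₂
          · omega
        · rintro rfl
          exact h₃ ⟨p, by omega, by omega, ⟨i, hwp⟩, rfl⟩

end StackTop

/-! ### Balance expressed through the tops -/

/-- The bi-infinite extension of a finite sequence by `ε`. -/
def extend {k n : ℕ} (w : Fin n → Option (Paren k)) (x : ℤ) : Option (Paren k) :=
  if h : 0 ≤ x ∧ x < n then w ⟨x.toNat, by omega⟩ else none

@[simp] theorem extend_coe {k n : ℕ} (w : Fin n → Option (Paren k)) (x : Fin n) :
    extend w ((x : ℕ) : ℤ) = w x := by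
  rw [extend, dif_pos (by omega)]
  rfl

theorem exists_fin_of_extend {k n : ℕ} {w : Fin n → Option (Paren k)} {x : ℤ} {a : Paren k}
    (h : extend w x = some a) : ∃ y : Fin n, x = ((y : ℕ) : ℤ) := by
  by_cases hx : 0 ≤ x ∧ x < n
  · exact ⟨⟨x.toNat, by omega⟩, by simp [hx.1]⟩
  · simp [extend, hx] at h

theorem extend_update {k n : ℕ} (w : Fin n → Option (Paren k)) (p : Fin n) (o : Option (Paren k))
    {x : ℤ} (hx : x ≠ ((p : ℕ) : ℤ)) : extend (Function.update w p o) x = extend w x := by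
  unfold extend
  split_ifs with h
  · refine Function.update_of_ne ?_ _ _
    rintro rfl
    exact hx (by simp [h.1])
  · rfl

/-- `st` lists the types of the opening parentheses at the positions `y`, `T y`, `T (T y)`, … -/
def HasTypes {k : ℕ} (w : ℤ → Option (Paren k)) (T : ℤ → ℤ) : ℤ → List (Fin k) → Prop
  | y, [] => y < 0
  | y, i :: st => w y = some (.inl i) ∧ HasTypes w T (T y) st

/-- `T` pops without looking at types, whereas `Closes` fails at the first mismatch. As long as no
mismatch occurs, `st` lists the types of the stack given by `T`, and the run succeeds if in addition
no position of the word is left on the stack at the end. -/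
theorem StackTop.closes_iff {k n : ℕ} {w : Fin n → Option (Paren k)} {T : ℤ → ℤ}
    (hT : StackTop (extend w) T) (m : ℕ) : ∀ (x : ℕ) (st : List (Fin k)), x + m = n →
      HasTypes (extend w) T (T x) st →
      (Closes ((List.ofFn w).drop x).reduceOption st ↔
        (∀ c : ℤ, x ≤ c → ∀ i, extend w c = some (.inr i) → extend w (T c) = some (.inl i)) ∧
        T n < 0) := by
  induction m with
  | zero =>
    rintro x st rfl hst
    have h₁ : Closes ((List.ofFn w).drop x).reduceOption st ↔ st = [] := by
      rw [List.drop_of_length_le (by simp)]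
      rfl
    have h₂ : st = [] ↔ T x < 0 := by
      constructor
      · rintro rfl
        exact hst
      · rcases st with _ | ⟨i, st⟩
        · simp
        · intro h
          obtain ⟨y, hy⟩ := exists_fin_of_extend hst.1
          omega
    rw [h₁, h₂]
    refine ⟨fun h => ⟨fun c hc i hi => ?_, h⟩, fun h => h.2⟩
    obtain ⟨y, hy⟩ := exists_fin_of_extend hi
    omega
  | succ m ih =>
    intro x st hx hst
    have hxn : x < n := by omega
    have hw : extend w x = w ⟨x, hxn⟩ := extend_coe w ⟨x, hxn⟩
    have split : ∀ P : ℤ → Prop, (∀ c : ℤ, x ≤ c → P c) ↔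
        P x ∧ ∀ c : ℤ, ((x + 1 : ℕ) : ℤ) ≤ c → P c := by
      intro P
      refine ⟨fun h => ⟨h x le_rfl, fun c hc => h c (by omega)⟩, fun h c hc => ?_⟩
      rcases eq_or_ne c x with rfl | hne
      · exact h.1
      · exact h.2 c (by omega)
    have hTx : T ((x + 1 : ℕ) : ℤ) = T (x + 1 : ℤ) := by push_cast; rfl
    rw [split, List.drop_eq_getElem_cons (by simpa using hxn), List.getElem_ofFn, hw]
    rcases hwx : w ⟨x, hxn⟩ with _ | i | i
    · rw [List.reduceOption_cons_of_none, ih (x + 1) st (by omega)]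
      · simp
      · rwa [hTx, hT.eps x (by omega) (hw.trans hwx)]
    · rw [List.reduceOption_cons_of_some, Closes, ih (x + 1) (i :: st) (by omega)]
      · simp
      · rw [hTx, hT.opn x (by omega) i (hw.trans hwx)]
        exact ⟨hw.trans hwx, hst⟩
    · rw [List.reduceOption_cons_of_some, Closes]
      rcases st with _ | ⟨j, st⟩
      -- There is nothing to close: the top is virtual and `extend` has no letter there, so both
      -- sides are false.
      · have : extend w (T x) ≠ some (.inl i) := by
          intro h
          obtain ⟨y, hy⟩ := exists_fin_of_extend h
          have : T x < 0 := hst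
          omega
        simp [this]
      · have h := ih (x + 1) st (by omega) (by
          rw [hTx, hT.cls x (by omega) i (hw.trans hwx)]
          exact hst.2)
        rw [hst.1]
        constructor
        · rintro ⟨st', e, h'⟩
          rw [List.cons.injEq] at e
          obtain ⟨rfl, rfl⟩ := e
          exact ⟨⟨fun _ e => by simpa using e, (h.1 h').1⟩, (h.1 h').2⟩
        · rintro ⟨⟨h₁, h₂⟩, h₃⟩
          have := h₁ i rfl
          simp only [Option.some.injEq, Sum.inl.injEq] at this
          exact ⟨st, by rw [this], h.2 ⟨h₂, h₃⟩⟩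

/-- The word is balanced if every closing parenthesis closes one of its type and every opening
parenthesis is closed. -/
theorem StackTop.wellBalanced_iff {k n : ℕ} {w : Fin n → Option (Paren k)} {T : ℤ → ℤ}
    (hT : StackTop (extend w) T) :
    WellBalanced (wordOf w) ↔
      (∀ (c : Fin n) i, w c = some (.inr i) → extend w (T (c : ℕ)) = some (.inl i)) ∧
      ∀ (z : Fin n) i, w z = some (.inl i) →
        ∃ (c : Fin n) (j : _), w c = some (.inr j) ∧ T (c : ℕ) = (z : ℕ) := by
  have h := hT.closes_iff n 0 [] (by omega) (by
    rw [Nat.cast_zero, hT.virt 0 le_rfl]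
    exact (by omega : (0 : ℤ) - 1 < 0))
  rw [List.drop_zero] at h
  rw [wellBalanced_iff_closes, wordOf, h]
  refine and_congr ?_ ?_
  · constructor
    · intro h c i hi
      exact h _ (by omega) i (by rwa [extend_coe])
    · intro h c _ i hi
      obtain ⟨y, rfl⟩ := exists_fin_of_extend hi
      exact h y i (by rwa [extend_coe] at hi)
  · constructor
    · intro h z i hi
      have hz : ¬ StackTop.Stack T (T n) ((z : ℕ) : ℤ) := fun h' => by
        have := hT.stack_le h'
        omega
      rw [hT.stack_top_iff n (by omega)] at hz
      by_contra hne
      refine hz ⟨by omega, ⟨i, by rwa [extend_coe]⟩, fun ⟨c, _, _, ⟨j, hj⟩, e⟩ => hne ?_⟩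
      obtain ⟨y, rfl⟩ := exists_fin_of_extend hj
      exact ⟨y, j, by rwa [extend_coe] at hj, e⟩
    · intro h
      by_contra h₀
      -- A nonnegative `T n` would itself be an opening parenthesis that is never closed.
      have hs := (hT.stack_top_iff n (z := T n) (by omega)).1 (StackTop.stack_self _)
      obtain ⟨hz, ⟨i, hi⟩, hc⟩ := hs
      obtain ⟨z, hz'⟩ := exists_fin_of_extend hi
      rw [hz', extend_coe] at hi
      obtain ⟨c, j, hj, e⟩ := h z i hi
      exact hc ⟨(c : ℕ), by omega, by omega, ⟨j, by rwa [extend_coe]⟩, by rw [e, hz']⟩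

/-! ### Expressions without bounded quantification -/

/-- The bound `z ≤ n`, met by every `z`. -/
def Bound.all : Bound where
  fn := fun n => n
  definable := ⟨⊤, fun n z => by simp [z.2.le]⟩

@[simp] theorem tuple_one {α : Type} (v : Option α) :
    (tuple fun _ : Fin 1 => v) = v.map fun a _ => a := by
  rcases v with _ | a <;> simp [tuple]

@[simp] theorem tuple_zero {α : Type} (v : Fin 0 → Option α) :
    tuple v = some (fun j => j.elim0) := by
  rw [tuple, dif_pos (fun j => j.elim0)]
  exact congrArg some (funext fun j => j.elim0)

namespace Expr

variable {τ loc : Schema} {I : Type} {sig : I → OpSig} {a l n : ℕ} {M : (i : I) → Machine (sig i) n}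

/-- The expression contains neither quantifiers nor queries. -/
def Simple : {κ : Kind} → {m : ℕ} → Expr τ loc sig a l κ m → Prop
  | _, _, .pvar _ => True
  | _, _, .xvar _ => True
  | _, _, .zvar _ => True
  | _, _, .bot => True
  | _, _, .plus s t => s.Simple ∧ t.Simple
  | _, _, .times s t => s.Simple ∧ t.Simple
  | _, _, .auxFn _ y => ∀ j, (y j).Simple
  | _, _, .locFn _ y => ∀ j, (y j).Simple
  | _, _, .ite c s t => c.Simple ∧ s.Simple ∧ t.Simple
  | _, _, .fq _ _ _ => False
  | _, _, .unique _ _ => False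
  | _, _, .eq s t => s.Simple ∧ t.Simple
  | _, _, .le s t => s.Simple ∧ t.Simple
  | _, _, .auxRel _ y => ∀ j, (y j).Simple
  | _, _, .locRel _ y => ∀ j, (y j).Simple
  | _, _, .rq _ _ _ => False
  | _, _, .ex _ _ => False
  | _, _, .not c => c.Simple
  | _, _, .and c d => c.Simple ∧ d.Simple
  | _, _, .or c d => c.Simple ∧ d.Simple

theorem Simple.ok (E : Env τ M a l) (L : Str loc n) {κ : Kind} {m : ℕ}
    {e : Expr τ loc sig a l κ m} (h : e.Simple) (z : Fin m → Fin n) : e.Ok E L z := by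
  induction e <;> simp_all [Simple, Ok]

/-- All work of a rule with simple terms thus comes from the range of its variable. -/
theorem Simple.work_le (M : (i : I) → Machine (sig i) n) {κ : Kind} {m : ℕ}
    {e : Expr τ loc sig a l κ m} (h : e.Simple) : e.work M ≤ 1 := by
  induction e <;> simp_all [Simple, work]

/-- The disjunction of a list of conditions. -/
def disj {m : ℕ} : List (Expr τ loc sig a l .cond m) → Expr τ loc sig a l .cond m
  | [] => .eq .bot .bot
  | c :: cs => .or c (disj cs)

@[simp] theorem eval_disj (E : Env τ M a l) (L : Str loc n) {m : ℕ} (z : Fin m → Fin n)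
    (cs : List (Expr τ loc sig a l .cond m)) :
    (disj cs).eval E L z ↔ ∃ c ∈ cs, c.eval E L z := by
  induction cs with
  | nil => simp [disj, eval]
  | cons c cs ih => simp [disj, eval, ih]

theorem simple_disj {m : ℕ} {cs : List (Expr τ loc sig a l .cond m)} (h : ∀ c ∈ cs, c.Simple) :
    (disj cs).Simple := by
  induction cs with
  | nil => simp [disj, Simple]
  | cons c cs ih => simp_all [disj, Simple]

theorem ok_disj (E : Env τ M a l) (L : Str loc n) {m : ℕ} (z : Fin m → Fin n)
    {cs : List (Expr τ loc sig a l .cond m)} (h : ∀ c ∈ cs, c.Ok E L z) :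
    (disj cs).Ok E L z := by
  induction cs with
  | nil => simp [disj, Ok]
  | cons c cs ih => simp_all [disj, Ok]

theorem work_disj_le (M : (i : I) → Machine (sig i) n) {m N : ℕ} (hN : 1 ≤ N)
    {cs : List (Expr τ loc sig a l .cond m)} (h : ∀ c ∈ cs, c.work M ≤ N) :
    (disj cs).work M ≤ N := by
  induction cs with
  | nil => simpa [disj, work] using hN
  | cons c cs ih => simp_all [disj, work]

end Expr

/-! ### The program maintaining the stack -/

namespace StackProgram

/-- The auxiliary functions, all of them unary: `real x` is the top of the stack before `x` if that
is a position in `[n]`, and `virt x` is `j` if it is the position `-1 - j`. The functions `above` and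
`aboveVirt` map an element of a stack to the next higher one. -/
inductive FnSym
  | real | virt | above | aboveVirt | pred | succ
  deriving DecidableEq

instance : Fintype FnSym :=
  ⟨{.real, .virt, .above, .aboveVirt, .pred, .succ}, fun f => by cases f <;> simp⟩

/-- The relation `some σ` holds at the positions with letter `σ`, the relation `none` at the opening
parentheses that are closed. -/
abbrev schema (k : ℕ) : Schema where
  Rel := Option (Paren k)
  Fn := FnSym
  relAr := fun _ => 1
  fnAr := fun _ => 1

/-- The change operations; their parameter is the position of a change of the word. -/
inductive Op (k : ℕ)
  | clear
  | mark (before : Bool)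
  | link (incl : Bool)
  | up
  | down
  | write (o : Option (Paren k))
  deriving Fintype

/-- The query `some σ` asks for the letter of a position, the query `none` for balance. -/
abbrev sig (k : ℕ) : OpSig where
  Chg := Op k
  RQ := Option (Paren k)
  FQ := Empty
  chgAr := fun _ => 1
  rqAr := fun q => match q with | some _ => 1 | none => 0
  fqAr := fun _ => 0

section Expressions

variable {k a l m : ℕ}

/-- Terms and conditions of the program. -/
abbrev Ex (k a l : ℕ) (κ : Kind) (m : ℕ) : Type := Expr (schema k) Schema.nil noSig a l κ m

/-- Application of an auxiliary function. -/
def app (f : FnSym) (t : Ex k a l .term m) : Ex k a l .term m := .auxFn (τ := schema k) f fun _ => t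

/-- The letter of `t` is `σ`. -/
def letter (σ : Paren k) (t : Ex k a l .term m) : Ex k a l .cond m :=
  .auxRel (τ := schema k) (some σ) fun _ => t

/-- The position `t` is marked as closed. -/
def closed (t : Ex k a l .term m) : Ex k a l .cond m := .auxRel (τ := schema k) none fun _ => t

/-- The letter of `t` is an opening parenthesis. -/
def opening (t : Ex k a l .term m) : Ex k a l .cond m :=
  .disj ((List.finRange k).map fun i => letter (.inl i) t)

/-- The letter of `t` is a closing parenthesis. -/
def closing (t : Ex k a l .term m) : Ex k a l .cond m :=
  .disj ((List.finRange k).map fun i => letter (.inr i) t)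

/-- The letters of `s` and `t` are parentheses of the same type. -/
def matching (s t : Ex k a l .term m) : Ex k a l .cond m :=
  .disj ((List.finRange k).map fun i => .and (letter (.inl i) s) (letter (.inr i) t))

/-- The term `t` is defined. -/
def defined (t : Ex k a l .term m) : Ex k a l .cond m := .eq t t

/-- The negation of `t ≤ s`. -/
def less (s t : Ex k a l .term m) : Ex k a l .cond m := .not (.le t s)

end Expressions

variable {k : ℕ}

/-- The parameter. -/
abbrev P : Ex k 1 1 .term 0 := .pvar 0

/-- The variable. -/
abbrev X : Ex k 1 1 .term 0 := .xvar 0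

/-- The falsity. -/
abbrev never : Ex k 1 1 .cond 0 := .eq .bot .bot

/-- The position `x` is on the stack, which includes the parameter if `incl` is true. -/
def onStack : Bool → Ex k 1 1 .cond 0
  | true => .or (.eq X P) (.and (less X P) (.and (opening X) (.not (closed X))))
  | false => .and (less X P) (.and (opening X) (.not (closed X)))

/-- The rule that sets the symbol to `val` at `head`, for all `x`. -/
def rule {κ : Kind} (head : Ex k 1 1 .term 0) (val : Ex k 1 1 κ 0) :
    UpdateRule (schema k) noSig 1 κ 1 where
  loc := Schema.nil
  init := .instr .skip
  l := 1
  bound := fun _ => Bound.all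
  head := fun _ => head
  main := .ret val

open scoped Classical in
/-- The update rules for relations. -/
noncomputable def updRel : (c : Op k) → Option (Paren k) →
    Option (UpdateRule (schema k) noSig 1 .cond 1)
  | .clear, none => some (rule X never)
  | .mark true, none => some (rule (app .real X) (.and (closing X) (less X P)))
  | .mark false, none => some (rule (app .real X) (closing X))
  | .write o, some σ => some (rule P (if o = some σ then .not never else never))
  | _, _ => none

/-- The update rules for functions. -/
def updFn : (c : Op k) → FnSym → Option (UpdateRule (schema k) noSig 1 .term 1)
  | .clear, .above => some (rule X .bot)
  | .clear, .aboveVirt => some (rule X .bot)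
  | .link b, .above => some (rule (.ite (onStack b) (app .real X) .bot) X)
  | .link b, .aboveVirt => some (rule (.ite (.and (onStack b) (.not (defined (app .real X))))
      (app .virt X) .bot) X)
  | .up, .real => some (rule X (.ite (less P X)
      (.ite (defined (app .real X))
        (.ite (.le (app .real X) P) (app .above (app .real X)) (app .real X))
        (app .aboveVirt (app .virt X)))
      (app .real X)))
  | .up, .virt => some (rule X (.ite (less P X) (app .pred (app .virt X)) (app .virt X)))
  -- For a virtual top `real x` is undefined and the comparison with the parameter is false. Then
  -- `real` stays undefined, and `virt` grows by one since `T` is the predecessor map on negative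
  -- positions.
  | .down, .real => some (rule X (.ite (.and (less P X) (.le (app .real X) P))
      (app .real (app .real X)) (app .real X)))
  | .down, .virt => some (rule X (.ite (less P X)
      (.ite (.le (app .real X) P) (app .virt (app .real X)) (app .succ (app .virt X)))
      (app .virt X)))
  | _, _ => none

section Start

open FirstOrder FirstOrder.Language

/-- The symbol `≤`. -/
def leSym : arith.Relations 2 := ArithRel.le

/-- The formula `s ≤ t`. -/
def leFormula {α : Type} {m : ℕ} (s t : arith.Term (α ⊕ Fin m)) : arith.BoundedFormula α m :=
  Relations.boundedFormula₂ leSym s t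

@[simp] theorem realize_leFormula {α : Type} {m n : ℕ} (s t : arith.Term (α ⊕ Fin m))
    (v : α → Fin n) (xs : Fin m → Fin n) : (leFormula s t).Realize v xs ↔
      s.realize (Sum.elim v xs) ≤ t.realize (Sum.elim v xs) := by
  rw [leFormula, BoundedFormula.realize_rel₂]
  rfl

/-- `s` is the immediate successor of `t`. -/
def succFormula (s t : Fin 2) : arith.Formula (Fin 2) :=
  (leFormula (m := 0) (.var (.inl s)) (.var (.inl t))).not ⊓
    (leFormula (.var (.inr 0)) (.var (.inl t)) ⊔ leFormula (.var (.inl s)) (.var (.inr 0))).all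

/-- `s` is the least element. -/
def zeroFormula (s : Fin 2) : arith.Formula (Fin 2) :=
  (leFormula (m := 1) (.var (.inl s)) (.var (.inr 0))).all

theorem realize_succFormula {n : ℕ} (s t : Fin 2) (v : Fin 2 → Fin n) :
    (succFormula s t).Realize v ↔ (v s : ℕ) = v t + 1 := by
  have h : (succFormula s t).Realize v ↔ ¬ v s ≤ v t ∧ ∀ u : Fin n, u ≤ v t ∨ v s ≤ u := by
    simp [succFormula, Formula.Realize, Fin.snoc]
  rw [h]
  constructor
  · rintro ⟨h₁, h₂⟩
    have h₃ : (v t : ℕ) + 1 < n := by omega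
    have := h₂ ⟨v t + 1, h₃⟩
    simp only [Fin.le_def] at this h₁
    omega
  · intro h
    simp only [Fin.le_def]
    exact ⟨by omega, fun u => by omega⟩

theorem realize_zeroFormula {n : ℕ} (s : Fin 2) (v : Fin 2 → Fin n) :
    (zeroFormula s).Realize v ↔ (v s : ℕ) = 0 := by
  have h : (zeroFormula s).Realize v ↔ ∀ u : Fin n, v s ≤ u := by
    simp [zeroFormula, Formula.Realize, Fin.snoc]
  rw [h]
  constructor
  · intro h
    have := h ⟨0, (v s).pos⟩
    simpa [Fin.le_def] using this
  · intro h u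
    simp [Fin.le_def, h]

/-- The initial functions. -/
def fnStart : FnSym → arith.Formula (Fin 2)
  | .virt => zeroFormula 1
  | .pred => succFormula 0 1
  | .succ => succFormula 1 0
  | _ => ⊥

end Start

/-- The answer to the query for balance. -/
def balanced : Ex k 0 0 .cond 0 :=
  -- If the top at a closing parenthesis is virtual, `real` is undefined there, so `matching` is
  -- false, as required.
  .not (.ex Bound.all (.or (.and (opening (.zvar 0)) (.not (closed (.zvar 0))))
    (.and (closing (.zvar 0)) (.not (matching (app .real (.zvar 0)) (.zvar 0))))))

/-- The rules. -/
noncomputable def rules (k : ℕ) : Rules (schema k) noSig (sig k) where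
  relStart := fun _ => ⊥
  fnStart := fnStart
  updRel := updRel
  updFn := updFn
  rq := fun q =>
    match q with
    | some σ => ⟨Schema.nil, .ret (letter σ (.pvar (0 : Fin 1)))⟩
    | none => ⟨Schema.nil, .ret balanced⟩
  fq := fun q => q.elim

/-- The program. -/
noncomputable def program (k : ℕ) : Program (sig k) :=
  .mk (schema k) Empty inferInstance noSig (fun i => i.elim) (rules k)
    fun _ i _ _ _ _ => i.elim

end StackProgram

namespace StackProgram

variable {k n : ℕ}

/-! ### Semantics of the rules -/

section Eval

variable {a l m : ℕ} {M : (i : Empty) → Machine (noSig i) n} (E : Env (schema k) M a l)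
  (L : Str Schema.nil n) (z : Fin m → Fin n)

theorem eval_app (f : FnSym) (t : Ex k a l .term m) :
    (app f t).eval E L z = (t.eval E L z).bind fun y => E.aux.fn f fun _ => y := by
  simp only [app, Expr.eval, tuple_one]
  cases Expr.eval _ _ t _ <;> rfl

theorem eval_letter (σ : Paren k) (t : Ex k a l .term m) :
    (letter σ t).eval E L z ↔ ∃ y, t.eval E L z = some y ∧ E.aux.rel (some σ) fun _ => y := by
  simp only [letter, Expr.eval, tuple_one]
  cases Expr.eval _ _ t _ <;> simp

theorem eval_closed (t : Ex k a l .term m) :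
    (closed t).eval E L z ↔ ∃ y, t.eval E L z = some y ∧ E.aux.rel none fun _ => y := by
  simp only [closed, Expr.eval, tuple_one]
  cases Expr.eval _ _ t _ <;> simp

theorem eval_opening (t : Ex k a l .term m) : (opening t).eval E L z ↔
    ∃ i y, t.eval E L z = some y ∧ E.aux.rel (some (.inl i)) fun _ => y := by
  simp [opening, eval_letter]

theorem eval_closing (t : Ex k a l .term m) : (closing t).eval E L z ↔
    ∃ i y, t.eval E L z = some y ∧ E.aux.rel (some (.inr i)) fun _ => y := by
  simp [closing, eval_letter]

theorem eval_matching (s t : Ex k a l .term m) : (matching s t).eval E L z ↔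
    ∃ i, (∃ y, s.eval E L z = some y ∧ E.aux.rel (some (.inl i)) fun _ => y) ∧
      ∃ y, t.eval E L z = some y ∧ E.aux.rel (some (.inr i)) fun _ => y := by
  simp [matching, Expr.eval, eval_letter]

end Eval

/-- The value of an expression for parameter `p` and variable `x`. -/
noncomputable def den (aux : Str (schema k) n) (p x : Fin n) {κ : Kind} (e : Ex k 1 1 κ 0) :
    Val n κ :=
  e.eval (⟨aux, fun i => i.elim, fun _ => p, fun _ => x⟩ :
    Env (schema k) (fun i : Empty => (i.elim : Machine (noSig i) n)) 1 1)
    (LState.nil Schema.nil n).toStr Fin.elim0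

section Den

variable (aux : Str (schema k) n) (p x : Fin n)

@[simp] theorem den_P : den aux p x P = some p := rfl

@[simp] theorem den_X : den aux p x X = some x := rfl

@[simp] theorem den_bot : den aux p x .bot = none := rfl

@[simp] theorem den_app (f : FnSym) (t : Ex k 1 1 .term 0) :
    den aux p x (app f t) = (den aux p x t).bind fun y => aux.fn f fun _ => y :=
  eval_app _ _ _ f t

open scoped Classical in
@[simp] theorem den_ite (c : Ex k 1 1 .cond 0) (s t : Ex k 1 1 .term 0) :
    den aux p x (.ite c s t) = if den aux p x c then den aux p x s else den aux p x t := by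
  simp only [den, Expr.eval]
  congr

@[simp] theorem den_never : den aux p x never ↔ False := by
  simp [den, Expr.eval]

@[simp] theorem den_not (c : Ex k 1 1 .cond 0) : den aux p x (.not c) ↔ ¬ den aux p x c := by
  simp only [den, Expr.eval]

@[simp] theorem den_and (c d : Ex k 1 1 .cond 0) :
    den aux p x (.and c d) ↔ den aux p x c ∧ den aux p x d := by
  simp only [den, Expr.eval]

@[simp] theorem den_or (c d : Ex k 1 1 .cond 0) :
    den aux p x (.or c d) ↔ den aux p x c ∨ den aux p x d := by
  simp only [den, Expr.eval]

@[simp] theorem den_eq (s t : Ex k 1 1 .term 0) :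
    den aux p x (.eq s t) ↔ ∃ u, den aux p x s = some u ∧ den aux p x t = some u := by
  simp only [den, Expr.eval]

@[simp] theorem den_le (s t : Ex k 1 1 .term 0) :
    den aux p x (.le s t) ↔ ∃ u v, den aux p x s = some u ∧ den aux p x t = some v ∧ u ≤ v := by
  simp only [den, Expr.eval]

@[simp] theorem den_closed (t : Ex k 1 1 .term 0) :
    den aux p x (closed t) ↔ ∃ y, den aux p x t = some y ∧ aux.rel none fun _ => y :=
  eval_closed _ _ _ t

@[simp] theorem den_opening : den aux p x (opening X) ↔
    ∃ i, aux.rel (some (.inl i)) fun _ => x :=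
  (eval_opening _ _ _ X).trans (by simp [Expr.eval])

@[simp] theorem den_closing : den aux p x (closing X) ↔
    ∃ i, aux.rel (some (.inr i)) fun _ => x :=
  (eval_closing _ _ _ X).trans (by simp [Expr.eval])

end Den

section Rule

variable {M : (i : Empty) → Machine (noSig i) n} {S : (i : Empty) → (M i).State}
  (aux : Str (schema k) n) (p : Fin 1 → Fin n)

theorem value_rule {κ : Kind} (h : Ex k 1 1 .term 0) (v : Ex k 1 1 κ 0) (x : Fin 1 → Fin n) :
    (rule h v).value aux S p x = den aux (p 0) (x 0) v := by
  -- Families over `Empty` are equal, but not by definition; hence the rewriting before `rfl`.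
  obtain rfl : M = fun i => i.elim := funext fun i => i.elim
  have hp : (fun _ => p 0) = p := funext fun j => by rw [Subsingleton.elim j 0]
  have hx : (fun _ => x 0) = x := funext fun j => by rw [Subsingleton.elim j 0]
  have hS : S = fun i => i.elim := funext fun i => i.elim
  unfold den
  rw [hp, hx, hS]
  rfl

theorem target_rule {κ : Kind} (h : Ex k 1 1 .term 0) (v : Ex k 1 1 κ 0) (x : Fin 1 → Fin n)
    (b : Fin 1 → Fin n) :
    (rule h v).target aux p x = some b ↔ den aux (p 0) (x 0) h = some (b 0) := by
  have hp : (fun _ => p 0) = p := funext fun j => by rw [Subsingleton.elim j 0]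
  have hx : (fun _ => x 0) = x := funext fun j => by rw [Subsingleton.elim j 0]
  have hd : (rule h v).target aux p x = (den aux (p 0) (x 0) h).map fun y _ => y := by
    rw [← tuple_one]
    unfold den
    rw [hp, hx]
    rfl
  rw [hd]
  cases den aux (p 0) (x 0) h with
  | none => simp
  | some y =>
    simp only [Option.map_some, Option.some.injEq]
    refine ⟨fun e => by rw [← e], fun e => funext fun j => by rw [e, Subsingleton.elim j 0]⟩

theorem constraint_rule {κ : Kind} (h : Ex k 1 1 .term 0) (v : Ex k 1 1 κ 0)
    (x : Fin 1 → Fin n) : (rule h v).Constraint x :=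
  fun i => (x i).2.le

theorem exists_target_rule {κ : Kind} (h : Ex k 1 1 .term 0) (v : Ex k 1 1 κ 0)
    (b : Fin 1 → Fin n) (Z : (Fin 1 → Fin n) → Prop) (Z' : Fin n → Prop)
    (hZ : ∀ x, Z x ↔ Z' (x 0)) :
    (∃ x, (rule h v).Constraint x ∧ (rule h v).target aux p x = some b ∧ Z x) ↔
      ∃ x, den aux (p 0) x h = some (b 0) ∧ Z' x := by
  constructor
  · rintro ⟨x, _, hx, hz⟩
    exact ⟨x (0 : Fin 1), (target_rule aux p h v x b).1 hx, (hZ x).1 hz⟩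
  · rintro ⟨x, hx, hz⟩
    exact ⟨fun _ => x, constraint_rule _ _ _, (target_rule aux p h v _ b).2 hx, (hZ _).2 hz⟩

theorem newRel_rule (h : Ex k 1 1 .term 0) (v : Ex k 1 1 .cond 0)
    (old : (Fin 1 → Fin n) → Prop) (b : Fin 1 → Fin n) :
    (rule h v).newRel aux S p old b ↔
      (∃ x, den aux (p 0) x h = some (b 0) ∧ den aux (p 0) x v) ∨
      (old b ∧ ¬ ∃ x, den aux (p 0) x h = some (b 0)) := by
  have h₁ := exists_target_rule aux p h v b (fun x => (rule h v).value aux S p x)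
    (fun x => den aux (p 0) x v) fun x => iff_of_eq (value_rule aux p h v x)
  have h₂ := exists_target_rule aux p h v b (fun _ => True) (fun _ => True) fun x => Iff.rfl
  simp only [and_true] at h₂
  rw [UpdateRule.newRel, h₁, h₂]

/-- The semantics chooses an arbitrary `x` writing at `b`, so the value is determined only if all of
them write the same. -/
theorem newFn_rule_of_eq (h : Ex k 1 1 .term 0) (v : Ex k 1 1 .term 0)
    (old : (Fin 1 → Fin n) → Option (Fin n)) (b : Fin 1 → Fin n) (o : Option (Fin n))
    (hex : ∃ x, den aux (p 0) x h = some (b 0))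
    (hall : ∀ x, den aux (p 0) x h = some (b 0) → den aux (p 0) x v = o) :
    (rule h v).newFn aux S p old b = o := by
  have h₂ := exists_target_rule aux p h v b (fun _ => True) (fun _ => True) fun x => Iff.rfl
  simp only [and_true] at h₂
  have hex' := h₂.2 hex
  rw [UpdateRule.newFn, dif_pos hex']
  refine (value_rule aux p h v _).trans ?_
  exact hall _ ((target_rule aux p h v _ b).1 hex'.choose_spec.2)

theorem newFn_rule_of_not (h : Ex k 1 1 .term 0) (v : Ex k 1 1 .term 0)
    (old : (Fin 1 → Fin n) → Option (Fin n)) (b : Fin 1 → Fin n)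
    (hex : ¬ ∃ x, den aux (p 0) x h = some (b 0)) :
    (rule h v).newFn aux S p old b = old b := by
  have h₂ := exists_target_rule aux p h v b (fun _ => True) (fun _ => True) fun x => Iff.rfl
  simp only [and_true] at h₂
  rw [UpdateRule.newFn, dif_neg (fun h' => hex (h₂.1 h'))]

theorem newFn_rule_X (v : Ex k 1 1 .term 0)
    (old : (Fin 1 → Fin n) → Option (Fin n)) (b : Fin 1 → Fin n) :
    (rule X v).newFn aux S p old b = den aux (p 0) (b 0) v := by
  refine newFn_rule_of_eq aux p X v old b _ ⟨b 0, rfl⟩ fun x hx => ?_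
  rw [den_X, Option.some.injEq] at hx
  rw [hx]

theorem ok_rule {κ : Kind} {h : Ex k 1 1 .term 0} {v : Ex k 1 1 κ 0} (hh : h.Simple)
    (hv : v.Simple) (hagree : κ = .term → ∀ x x' b, den aux (p 0) x h = some b →
      den aux (p 0) x' h = some b → den aux (p 0) x v = den aux (p 0) x' v) :
    (rule h v).Ok aux S p := by
  refine ⟨trivial, fun x _ => ⟨fun _ => hh.ok _ _ _, hv.ok _ _ _⟩, fun hκ x x' b _ _ hx hx' => ?_⟩
  refine (value_rule aux p h v x).trans (Eq.trans ?_ (value_rule aux p h v x').symm)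
  exact hagree hκ _ _ _ ((target_rule aux p h v x b).1 hx) ((target_rule aux p h v x' b).1 hx')

theorem work_rule {κ : Kind} {h : Ex k 1 1 .term 0} {v : Ex k 1 1 κ 0} (hh : h.Simple)
    (hv : v.Simple) : (rule h v).work M ≤ n + 1 := by
  refine max_le (by simp [rule, InitProc.work, Instr.work]) ?_
  have h₁ : (rule h v).main.work M ≤ 1 := hv.work_le M
  have h₂ : (Finset.univ.sup fun j => ((rule h v).head j).work
      (fun i : Empty => (i.elim : Machine (noSig i) n))) ≤ 1 :=
    Finset.sup_le fun j _ => hh.work_le _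
  calc _ ≤ (∏ _i : Fin 1, (n + 1)) * 1 := Nat.mul_le_mul le_rfl (max_le h₁ h₂)
    _ = n + 1 := by simp

end Rule

/-! ### The rules are simple -/

theorem simple_opening : (opening X : Ex k 1 1 .cond 0).Simple := by
  refine Expr.simple_disj fun c hc => ?_
  obtain ⟨i, _, rfl⟩ := List.mem_map.1 hc
  exact fun _ => trivial

theorem simple_closing : (closing X : Ex k 1 1 .cond 0).Simple := by
  refine Expr.simple_disj fun c hc => ?_
  obtain ⟨i, _, rfl⟩ := List.mem_map.1 hc
  exact fun _ => trivial

theorem simple_onStack (b : Bool) : (onStack b : Ex k 1 1 .cond 0).Simple := by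
  cases b <;> simp [onStack, Expr.Simple, simple_opening, less, closed]

theorem updRel_eq_rule {c : Op k} {R : Option (Paren k)} {r} (h : updRel c R = some r) :
    ∃ t v, t.Simple ∧ v.Simple ∧ r = rule t v := by
  unfold updRel at h
  split at h <;> try cases h
  all_goals refine ⟨_, _, ?_, ?_, rfl⟩
  all_goals try split_ifs
  all_goals simp [Expr.Simple, app, simple_closing, less]

/-- The last clause singles out `link` as the only operation whose function rules can write several
times at one argument. -/
theorem updFn_eq_rule {c : Op k} {f : FnSym} {r} (h : updFn c f = some r) :
    ∃ t v, t.Simple ∧ v.Simple ∧ r = rule t v ∧ ((∀ b, c ≠ .link b) → t = X) := by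
  unfold updFn at h
  split at h <;> try cases h
  all_goals refine ⟨_, _, ?_, ?_, rfl, ?_⟩
  all_goals simp [Expr.Simple, app, simple_onStack, less, defined]

end StackProgram

namespace StackProgram

variable {k n : ℕ}

/-! ### The effect of the change operations -/

/-- The letters of the word are `w`. -/
def Letters (w : Fin n → Option (Paren k)) (aux : Str (schema k) n) : Prop :=
  ∀ σ x, aux.rel (some σ) (fun _ => x) ↔ w x = some σ

/-- The functions represent the tops `T` of the stacks. -/
structure Tops (T : ℤ → ℤ) (aux : Str (schema k) n) : Prop where
  real : ∀ x y : Fin n, aux.fn .real (fun _ => x) = some y ↔ T (x : ℕ) = (y : ℕ)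
  -- Only one implication is required: where the top is a position of the word, `virt` may have any
  -- value.
  virt : ∀ x j : Fin n, T (x : ℕ) = -1 - (j : ℕ) → aux.fn .virt (fun _ => x) = some j
  pred : ∀ i j : Fin n, aux.fn .pred (fun _ => i) = some j ↔ (i : ℕ) = j + 1
  succ : ∀ i j : Fin n, aux.fn .succ (fun _ => i) = some j ↔ (j : ℕ) = i + 1

/-- The elements `T c` for closing parentheses `c`, which are before `p` if `b` is true, are marked. -/
def Marked (w : Fin n → Option (Paren k)) (T : ℤ → ℤ) (b : Bool) (p : Fin n)
    (aux : Str (schema k) n) : Prop :=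
  ∀ z, aux.rel none (fun _ => z) ↔
    ∃ c : Fin n, (∃ i, w c = some (.inr i)) ∧ (b = true → c < p) ∧ T (c : ℕ) = (z : ℕ)

/-- Nothing is marked, and no stack is represented. -/
structure Cleared (aux : Str (schema k) n) : Prop where
  mark : ∀ z, ¬ aux.rel none fun _ => z
  above : ∀ z, aux.fn .above (fun _ => z) = none
  aboveVirt : ∀ z, aux.fn .aboveVirt (fun _ => z) = none

/-- The stack with top `y` is represented. -/
structure Linked (T : ℤ → ℤ) (y : ℤ) (aux : Str (schema k) n) : Prop where
  above : ∀ z q : Fin n, aux.fn .above (fun _ => z) = some q ↔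
    StackTop.Stack T y (q : ℕ) ∧ T (q : ℕ) = (z : ℕ)
  aboveVirt : ∀ j q : Fin n, aux.fn .aboveVirt (fun _ => j) = some q ↔
    StackTop.Stack T y (q : ℕ) ∧ T (q : ℕ) = -1 - (j : ℕ)

/-- By `StackTop.ge` a virtual top `-1 - j` at `x` has `j ≤ x < n`, so its code `j` fits into the
domain. -/
theorem Tops.real_or {w : Fin n → Option (Paren k)} {T : ℤ → ℤ} {aux : Str (schema k) n}
    (hT : StackTop (extend w) T) (h : Tops T aux) (x : Fin n) :
    (∃ y : Fin n, T (x : ℕ) = (y : ℕ) ∧ aux.fn .real (fun _ => x) = some y) ∨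
    (T (x : ℕ) < 0 ∧ aux.fn .real (fun _ => x) = none ∧
      ∃ j : Fin n, T (x : ℕ) = -1 - (j : ℕ) ∧ aux.fn .virt (fun _ => x) = some j) := by
  have h₁ := hT.lt (x : ℕ)
  have h₂ := hT.ge (x := (x : ℕ)) (by omega)
  rcases lt_or_ge (T (x : ℕ)) 0 with hx | hx
  · refine .inr ⟨hx, ?_, ⟨(-1 - T (x : ℕ)).toNat, by omega⟩, by dsimp only; omega,
      h.virt _ _ (by dsimp only; omega)⟩
    rw [Option.eq_none_iff_forall_ne_some]
    intro y hy
    rw [h.real] at hy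
    omega
  · exact .inl ⟨⟨(T (x : ℕ)).toNat, by omega⟩, by dsimp only; omega,
      (h.real _ _).2 (by dsimp only; omega)⟩

/-- The program on the domain `[n]`. -/
noncomputable abbrev machine (k n : ℕ) : Machine (sig k) n :=
  (rules k).machine fun i : Empty => (i.elim : Machine (noSig i) n)

/-- On states with property `A` the operation `c` is executed properly and leads to a state with
property `B`. -/
def Step (c : Op k) (p : Fin n) (A B : Str (schema k) n → Prop) : Prop :=
  ∀ s : (machine k n).State, A s.1 →
    (machine k n).chgOk c (fun _ => p) s ∧ B ((machine k n).chg c (fun _ => p) s).1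

theorem chgOk_of_ne {c : Op k} (hc : ∀ b, c ≠ .link b) (p : Fin 1 → Fin n)
    (s : (machine k n).State) : (machine k n).chgOk c p s := by
  refine ⟨fun R r h => ?_, fun f r h => ?_⟩
  · obtain ⟨t, v, ht, hv, rfl⟩ := updRel_eq_rule h
    exact ok_rule _ _ ht hv fun h => by cases h
  · obtain ⟨t, v, ht, hv, rfl, hX⟩ := updFn_eq_rule h
    obtain rfl := hX hc
    refine ok_rule _ _ ht hv fun _ x x' b hx hx' => ?_
    rw [den_X, Option.some.injEq] at hx hx'
    rw [hx, hx']

theorem step_clear (w : Fin n → Option (Paren k)) (T : ℤ → ℤ) (p : Fin n) :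
    Step .clear p (fun aux => Letters w aux ∧ Tops T aux)
      (fun aux => Letters w aux ∧ Tops T aux ∧ Cleared aux) := by
  rintro ⟨aux, S⟩ ⟨hw, hT⟩
  dsimp only at hw hT
  refine ⟨chgOk_of_ne (by simp) _ _, hw, ⟨hT.real, hT.virt, hT.pred, hT.succ⟩,
    fun z => ?_, fun z => ?_, fun z => ?_⟩
  · change ¬ (rule X never).newRel aux S _ _ _
    rw [newRel_rule]
    simp
  · change (rule X .bot).newFn aux S _ _ _ = none
    rw [newFn_rule_X]
    simp
  · change (rule X .bot).newFn aux S _ _ _ = none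
    rw [newFn_rule_X]
    simp

/-- Every closing `c` writes at `T c`, and a relation takes the disjunction of concurrent writes.
This computes the existential over `c` for all targets at once. Locations that nobody writes keep
their value, so the relation has to be cleared before. -/
theorem step_mark (w : Fin n → Option (Paren k)) (T : ℤ → ℤ) (b : Bool) (p : Fin n) :
    Step (.mark b) p (fun aux => Letters w aux ∧ Tops T aux ∧ Cleared aux)
      (fun aux => Letters w aux ∧ Tops T aux ∧ Marked w T b p aux ∧
        (∀ z, aux.fn .above (fun _ => z) = none) ∧
        ∀ z, aux.fn .aboveVirt (fun _ => z) = none) := by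
  rintro ⟨aux, S⟩ ⟨hw, hT, hc⟩
  dsimp only at hw hT hc
  refine ⟨chgOk_of_ne (by simp) _ _, ?_, ⟨hT.real, hT.virt, hT.pred, hT.succ⟩, fun z => ?_,
    hc.above, hc.aboveVirt⟩
  · cases b <;> exact hw
  · cases b
    · change (rule (app .real X) (closing X)).newRel aux S _ _ _ ↔ _
      rw [newRel_rule]
      simp [hT.real, hc.mark, hw _ _, and_comm]
    · change (rule (app .real X) (.and (closing X) (less X P))).newRel aux S _ _ _ ↔ _
      rw [newRel_rule]
      simp [hT.real, hc.mark, hw _ _, less]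
      refine exists_congr fun c => ?_
      tauto

/-- By `StackTop.stack_top_iff`, once the elements closed before `p` are marked, membership in the
stack can be tested without a quantifier. -/
theorem den_onStack {w : Fin n → Option (Paren k)} {T : ℤ → ℤ} (hT : StackTop (extend w) T)
    {b : Bool} {p : Fin n} {aux : Str (schema k) n} (hw : Letters w aux)
    (hm : Marked w T true p aux) (x : Fin n) :
    den aux p x (onStack b) ↔
      StackTop.Stack T (if b = true then ((p : ℕ) : ℤ) else T (p : ℕ)) (x : ℕ) := by
  have h : (x < p ∧ (∃ i, w x = some (.inl i)) ∧ ¬ aux.rel none fun _ => x) ↔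
      StackTop.Stack T (T (p : ℕ)) (x : ℕ) := by
    rw [hT.stack_top_iff p (by omega), hm x]
    refine and_congr (by omega) (and_congr (by simp) (not_congr ?_))
    constructor
    · rintro ⟨c, ⟨i, hi⟩, hc, e⟩
      have := hc rfl
      exact ⟨(c : ℕ), by omega, by omega, ⟨i, by simpa using hi⟩, e⟩
    · rintro ⟨c, h₀, hc, ⟨i, hi⟩, e⟩
      obtain ⟨y, rfl⟩ := exists_fin_of_extend hi
      exact ⟨y, ⟨i, by simpa using hi⟩, fun _ => by omega, e⟩
  cases b
  · simpa [onStack, less, hw _ _] using h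
  · rw [if_pos rfl, StackTop.stack_iff, ← h]
    simp [onStack, less, hw _ _, Fin.val_inj, eq_comm]

/-- The inverse of `T` is built by letting every stack element write itself at its image. An
undefined head means that nothing is written, so elements off the stack do not interfere. -/
theorem step_link {w : Fin n → Option (Paren k)} {T : ℤ → ℤ} (hT : StackTop (extend w) T)
    (b : Bool) (p : Fin n) :
    Step (.link b) p (fun aux => Letters w aux ∧ Tops T aux ∧ Marked w T true p aux ∧
        (∀ z, aux.fn .above (fun _ => z) = none) ∧ ∀ z, aux.fn .aboveVirt (fun _ => z) = none)
      (fun aux => Letters w aux ∧ Tops T aux ∧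
        Linked T (if b = true then ((p : ℕ) : ℤ) else T (p : ℕ)) aux) := by
  rintro ⟨aux, S⟩ ⟨hw, ht, hm, ha, hv⟩
  dsimp only at hw ht hm ha hv
  have hs : ∀ x, den aux p x (onStack b) ↔ _ := den_onStack hT (b := b) hw hm
  generalize (if b = true then ((p : ℕ) : ℤ) else T (p : ℕ)) = q₀ at hs ⊢
  have h₁ : ∀ x z, den aux p x (.ite (onStack b) (app .real X) .bot) = some z ↔
      StackTop.Stack T q₀ (x : ℕ) ∧ T (x : ℕ) = (z : ℕ) := by
    intro x z
    rw [den_ite, hs]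
    split_ifs with h
    · simp [h, ht.real]
    · simp [h]
  have h₂ : ∀ x j, den aux p x (.ite (.and (onStack b) (.not (defined (app .real X))))
      (app .virt X) .bot) = some j ↔
      StackTop.Stack T q₀ (x : ℕ) ∧ T (x : ℕ) = -1 - (j : ℕ) := by
    intro x j
    have hx : den aux p x (defined (app .real X)) ↔ ∃ y, aux.fn .real (fun _ => x) = some y := by
      simp [defined]
    rw [den_ite, den_and, den_not, hs, hx]
    by_cases h : StackTop.Stack T q₀ (x : ℕ)
    · rcases ht.real_or hT x with ⟨y, hy, hy'⟩ | ⟨h₀, hy, j', hj', e⟩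
      · simp only [h, hy', hy]
        simp
        omega
      · simp [h, hy, hj', e, Fin.val_inj]
    · simp [h]
  have inj : ∀ {x x' : Fin n}, StackTop.Stack T q₀ (x : ℕ) → StackTop.Stack T q₀ (x' : ℕ) →
      T (x : ℕ) = T (x' : ℕ) → x = x' := by
    intro x x' h h' e
    have := hT.stack_injOn h h' e
    omega
  -- One argument for both functions: `g z` is `z` for `above` and `-1 - z` for `aboveVirt`.
  have key : ∀ (h : Ex k 1 1 .term 0) (g : Fin n → ℤ) (old : (Fin 1 → Fin n) → Option (Fin n)),
      (∀ x z, den aux p x h = some z ↔ StackTop.Stack T q₀ (x : ℕ) ∧ T (x : ℕ) = g z) →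
      (∀ z, old (fun _ => z) = none) → ∀ z q,
      (rule h X).newFn aux S (fun _ => p) old (fun _ => z) = some q ↔
        StackTop.Stack T q₀ (q : ℕ) ∧ T (q : ℕ) = g z := by
    intro h g old hh hold z q
    by_cases hex : ∃ x, StackTop.Stack T q₀ (x : Fin n) ∧ T ((x : Fin n) : ℕ) = g z
    · obtain ⟨x, hx, e⟩ := hex
      rw [newFn_rule_of_eq aux _ h X old _ (some x) ⟨x, (hh x z).2 ⟨hx, e⟩⟩]
      · rw [Option.some.injEq]
        refine ⟨fun e' => e' ▸ ⟨hx, e⟩, fun ⟨h', e'⟩ => inj hx h' (e.trans e'.symm)⟩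
      · intro y hy
        obtain ⟨hy, e'⟩ := (hh y z).1 hy
        rw [den_X, inj hx hy (e.trans e'.symm)]
    · rw [newFn_rule_of_not, hold]
      · simp only [reduceCtorEq, false_iff]
        exact fun h => hex ⟨q, h⟩
      · rintro ⟨x, hx⟩
        exact hex ⟨x, (hh x z).1 hx⟩
  refine ⟨⟨fun R r h => ?_, fun f r h => ?_⟩, hw, ⟨ht.real, ht.virt, ht.pred, ht.succ⟩,
    key _ _ _ h₁ ha, key _ _ _ h₂ hv⟩
  · obtain ⟨t, v, ht, hv, rfl⟩ := updRel_eq_rule (c := .link b) (R := R) h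
    exact ok_rule _ _ ht hv fun h => by cases h
  · cases f
    case above =>
      obtain rfl := Option.some.inj h
      refine ok_rule _ _ ?_ trivial fun _ x x' z hx hx' => ?_
      · simp [Expr.Simple, app, simple_onStack]
      · rw [h₁] at hx hx'
        exact congrArg some (inj hx.1 hx'.1 (hx.2.trans hx'.2.symm))
    case aboveVirt =>
      obtain rfl := Option.some.inj h
      refine ok_rule _ _ ?_ trivial fun _ x x' z hx hx' => ?_
      · simp [Expr.Simple, app, simple_onStack, defined]
      · rw [h₂] at hx hx'
        exact congrArg some (inj hx.1 hx'.1 (hx.2.trans hx'.2.symm))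
    all_goals cases h

open scoped Classical in
/-- The next higher element on the stack with top `y`. -/
noncomputable def nextAbove (n : ℕ) (T : ℤ → ℤ) (y z : ℤ) : ℤ :=
  if h : ∃ q : Fin n, StackTop.Stack T y (q : ℕ) ∧ T (q : ℕ) = z then ((h.choose : Fin n) : ℕ)
  else z + 1

/-- The default `z + 1` is correct for virtual elements: without a witness in `[n]` the element `q`
is negative, and then `T q = q - 1`. -/
theorem nextAbove_eq {w : ℤ → Option (Paren k)} {T : ℤ → ℤ} (hT : StackTop w T) {y : ℤ}
    (hy : y < n) (q : ℤ) (hq : StackTop.Stack T y q) : nextAbove n T y (T q) = q := by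
  have hle := hT.stack_le hq
  unfold nextAbove
  split_ifs with h
  · exact hT.stack_injOn h.choose_spec.1 hq h.choose_spec.2
  · have : q < 0 := by
      by_contra h₀
      refine h ⟨⟨q.toNat, by omega⟩, ?_⟩
      have : ((q.toNat : ℕ) : ℤ) = q := by omega
      simp only [this]
      exact ⟨hq, trivial⟩
    rw [hT.virt q this.le]
    omega

theorem step_up {w : Fin n → Option (Paren k)} {T : ℤ → ℤ} (hT : StackTop (extend w) T)
    {y : ℤ} {p : Fin n} (hy : y < n)
    (hmem : ∀ x, ((p : ℕ) : ℤ) < x → T x ≤ (p : ℕ) → ∃ q, StackTop.Stack T y q ∧ T x = T q) :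
    Step .up p (fun aux => Letters w aux ∧ Tops T aux ∧ Linked T y aux)
      (fun aux => Letters w aux ∧ Tops (fun x => if ((p : ℕ) : ℤ) < x ∧ T x ≤ (p : ℕ) then
        nextAbove n T y (T x) else T x) aux) := by
  rintro ⟨aux, S⟩ ⟨hw, ht, hl⟩
  dsimp only at hw ht hl
  refine ⟨chgOk_of_ne (by simp) _ _, hw, fun x z => ?_, fun x j hj => ?_, ht.pred, ht.succ⟩
  · change (rule X (.ite (less P X)
      (.ite (defined (app .real X))
        (.ite (.le (app .real X) P) (app .above (app .real X)) (app .real X))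
        (app .aboveVirt (app .virt X)))
      (app .real X))).newFn aux S _ _ _ = _ ↔ _
    rw [newFn_rule_X]
    by_cases hpx : p < x
    · have hpx' : ((p : ℕ) : ℤ) < (x : ℕ) := by omega
      rcases ht.real_or hT x with ⟨o, ho, e⟩ | ⟨h₀, e, j, hj, e'⟩
      · by_cases hop : o ≤ p
        · obtain ⟨q, hq, hTq⟩ := hmem (x : ℕ) hpx' (by omega)
          have h₁ := hT.lt q
          have h₂ := hT.stack_le hq
          -- Since `q` lies above the position `o` and at most at `y < n`, it is a position of the
          -- word.
          obtain ⟨q, rfl⟩ : ∃ q' : Fin n, q = (q' : ℕ) :=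
            ⟨⟨q.toNat, by omega⟩, by dsimp only; omega⟩
          have h₃ := (hl.above o q).2 ⟨hq, by omega⟩
          rw [if_pos (by omega), hTq, nextAbove_eq hT hy q hq]
          simp [less, defined, hpx, e, hop, h₃, Fin.val_inj]
        · rw [if_neg (by omega), ho]
          simp [less, defined, hpx, e, hop, Fin.val_inj]
      · obtain ⟨q, hq, hTq⟩ := hmem (x : ℕ) hpx' (by omega)
        rw [if_pos (by omega), hTq, nextAbove_eq hT hy q hq]
        have h₂ := hT.stack_le hq
        rcases lt_or_ge q 0 with hq₀ | hq₀
        -- The new top is virtual, so `real` has to become undefined. A value of `aboveVirt` would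
        -- be a second stack element with the same image as `q`.
        · have : aux.fn .aboveVirt (fun _ => j) ≠ some z := by
            intro h
            obtain ⟨h, h'⟩ := (hl.aboveVirt _ _).1 h
            have := hT.stack_injOn h hq (by omega)
            omega
          simp [less, defined, hpx, e, e', this]
          omega
        · obtain ⟨q, rfl⟩ : ∃ q' : Fin n, q = (q' : ℕ) :=
            ⟨⟨q.toNat, by omega⟩, by dsimp only; omega⟩
          have h₃ := (hl.aboveVirt j q).2 ⟨hq, by omega⟩
          simp [less, defined, hpx, e, e', h₃, Fin.val_inj]
    · rw [if_neg (by omega), ← ht.real]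
      simp [less, hpx]
  · change (rule X (.ite (less P X) (app .pred (app .virt X)) (app .virt X))).newFn aux S _ _ _ = _
    rw [newFn_rule_X]
    by_cases hpx : p < x
    · by_cases hp : T (x : ℕ) ≤ (p : ℕ)
      · obtain ⟨q, hq, hTq⟩ := hmem (x : ℕ) (by omega) hp
        rw [if_pos (by omega), hTq, nextAbove_eq hT hy q hq] at hj
        rw [hT.virt q (by omega)] at hTq
        have := hT.ge (x := (x : ℕ)) (by omega)
        -- The new top `-1 - j` is `q`, so the old one is `q - 1`, with code `j + 1`; the lower
        -- bound on tops keeps this code in the domain.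
        have h₁ := ht.virt x ⟨j + 1, by omega⟩ (by push_cast; omega)
        have h₂ := (ht.pred ⟨j + 1, by omega⟩ j).2 rfl
        simp [less, hpx, h₁, h₂]
      · rw [if_neg (by omega)] at hj
        omega
    · rw [if_neg (by omega)] at hj
      simp [less, hpx, ht.virt x j hj]

theorem step_down {w : Fin n → Option (Paren k)} {T : ℤ → ℤ} (hT : StackTop (extend w) T)
    (p : Fin n) :
    Step .down p (fun aux => Letters w aux ∧ Tops T aux)
      (fun aux => Letters w aux ∧ Tops (fun x => if ((p : ℕ) : ℤ) < x ∧ T x ≤ (p : ℕ) then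
        T (T x) else T x) aux) := by
  rintro ⟨aux, S⟩ ⟨hw, ht⟩
  dsimp only at hw ht
  refine ⟨chgOk_of_ne (by simp) _ _, hw, fun x z => ?_, fun x j hj => ?_, ht.pred, ht.succ⟩
  · change (rule X (.ite (.and (less P X) (.le (app .real X) P))
      (app .real (app .real X)) (app .real X))).newFn aux S _ _ _ = _ ↔ _
    rw [newFn_rule_X]
    by_cases hpx : p < x
    · rcases ht.real_or hT x with ⟨o, ho, e⟩ | ⟨h₀, e, j, hj, e'⟩
      · by_cases hop : o ≤ p
        · rw [if_pos (by omega), ho, ← ht.real]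
          simp [less, hpx, e, hop]
        · rw [if_neg (by omega), ho]
          simp [less, hpx, e, hop, Fin.val_inj]
      -- A virtual top is replaced by a lower virtual one, so both sides are false.
      · rw [if_pos (by omega), hT.virt _ h₀.le]
        simp [less, e]
        omega
    · rw [if_neg (by omega), ← ht.real]
      simp [less, hpx]
  · change (rule X (.ite (less P X)
      (.ite (.le (app .real X) P) (app .virt (app .real X)) (app .succ (app .virt X)))
      (app .virt X))).newFn aux S _ _ _ = _
    rw [newFn_rule_X]
    by_cases hpx : p < x
    · rcases ht.real_or hT x with ⟨o, ho, e⟩ | ⟨h₀, e, i, hi, e'⟩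
      · by_cases hop : o ≤ p
        · rw [if_pos (by omega), ho] at hj
          simp [less, hpx, e, hop, ht.virt o j hj]
        · rw [if_neg (by omega)] at hj
          omega
      · rw [if_pos (by omega), hT.virt _ h₀.le] at hj
        have := (ht.succ i j).2 (by omega)
        simp [less, hpx, e, e', this]
    · rw [if_neg (by omega)] at hj
      simp [less, hpx, ht.virt x j hj]

theorem step_write (w : Fin n → Option (Paren k)) (T : ℤ → ℤ) (o : Option (Paren k)) (p : Fin n) :
    Step (.write o) p (fun aux => Letters w aux ∧ Tops T aux)
      (fun aux => Letters (Function.update w p o) aux ∧ Tops T aux) := by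
  classical
  rintro ⟨aux, S⟩ ⟨hw, ht⟩
  dsimp only at hw ht
  refine ⟨chgOk_of_ne (by simp) _ _, fun σ x => ?_, ⟨ht.real, ht.virt, ht.pred, ht.succ⟩⟩
  change (rule P (if o = some σ then .not never else never)).newRel aux S _ _ _ ↔ _
  rw [newRel_rule]
  -- The head is the parameter and the variable `x` is a dummy; some `x` must exist for the write to
  -- happen.
  have : Nonempty (Fin n) := ⟨p⟩
  rcases eq_or_ne x p with rfl | hne
  · rw [Function.update_self]
    split_ifs with h <;> simp [h]
  · rw [Function.update_of_ne hne, ← hw]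
    simp [hne.symm]

end StackProgram

namespace StackProgram

variable {k n : ℕ}

/-! ### Sequences of change operations -/

/-- The operations `cs` lead from property `A` to property `B`. -/
def Runs (p : Fin n) : List (Op k) → (Str (schema k) n → Prop) → (Str (schema k) n → Prop) → Prop
  | [], A, B => ∀ aux, A aux → B aux
  | c :: cs, A, B => ∃ C, Step c p A C ∧ Runs p cs C B

/-- The auxiliary structure represents the word `w`. -/
def Inv (w : Fin n → Option (Paren k)) (aux : Str (schema k) n) : Prop :=
  ∃ T, StackTop (extend w) T ∧ Letters w aux ∧ Tops T aux ∧
    ∀ z, aux.rel none (fun _ => z) ↔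
      ∃ c : Fin n, (∃ i, w c = some (.inr i)) ∧ T (c : ℕ) = (z : ℕ)

/-- The operations after which everything is represented again. -/
def finish (o : Option (Paren k)) : List (Op k) := [.write o, .clear, .mark false]

/-- At this moment `T` already belongs to the new word while the letters are still the old ones,
which the preceding rounds had to read. The marks for the whole word are rebuilt last, because the
balance query uses them. -/
theorem runs_finish {w : Fin n → Option (Paren k)} {T : ℤ → ℤ} {p : Fin n} {o : Option (Paren k)}
    (hT : StackTop (extend (Function.update w p o)) T) :
    Runs p (finish o) (fun aux => Letters w aux ∧ Tops T aux) (Inv (Function.update w p o)) :=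
  ⟨_, step_write w T o p, _, step_clear _ T p, _, step_mark _ T false p,
    fun _ ⟨hw, ht, hm, _⟩ => ⟨T, hT, hw, ht, by simpa [Marked] using hm⟩⟩

theorem runs_down {w : Fin n → Option (Paren k)} {T : ℤ → ℤ} (hT : StackTop (extend w) T)
    {p : Fin n} {o : Option (Paren k)}
    (h : (w p = none ∧ ∃ i, o = some (.inr i)) ∨ (o = none ∧ ∃ i, w p = some (.inl i))) :
    Runs p (.down :: finish o) (fun aux => Letters w aux ∧ Tops T aux)
      (Inv (Function.update w p o)) :=
  ⟨_, step_down hT p, runs_finish (hT.down (by omega) (fun _ hx => extend_update w p o hx)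
    (by simpa using h))⟩

/-- The stack to be inverted has top `p` when an opening parenthesis is inserted, as `p` is about to
be pushed, and top `T p` when a closing one is deleted, as that element is no longer popped. -/
theorem runs_up {w : Fin n → Option (Paren k)} {T : ℤ → ℤ} (hT : StackTop (extend w) T)
    {p : Fin n} {o : Option (Paren k)} {b : Bool}
    (h : (w p = none ∧ (∃ i, o = some (.inl i)) ∧ b = true) ∨
      (o = none ∧ (∃ i, w p = some (.inr i)) ∧ b = false)) :
    Runs p (.clear :: .mark true :: .link b :: .up :: finish o)
      (fun aux => Letters w aux ∧ Tops T aux) (Inv (Function.update w p o)) := by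
  have hp := hT.lt (p : ℕ)
  have hq : (if b = true then ((p : ℕ) : ℤ) else T (p : ℕ)) ≤ (p : ℕ) := by split_ifs <;> omega
  obtain ⟨hmem, hT'⟩ := hT.up (p := (p : ℕ)) (by omega) (fun _ hx => extend_update w p o hx)
    (Q := StackTop.Stack T (if b = true then ((p : ℕ) : ℤ) else T (p : ℕ)))
    (c := nextAbove n T (if b = true then ((p : ℕ) : ℤ) else T (p : ℕ)))
    (fun q h => h.top) (fun q h => (hT.stack_le h).trans hq)
    (fun q h => nextAbove_eq hT (by omega) q h) (by
      rcases h with ⟨h₁, h₂, rfl⟩ | ⟨h₁, h₂, rfl⟩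
      · exact .inl ⟨by simpa using h₁, by simpa using h₂, StackTop.stack_self _⟩
      · exact .inr ⟨by simpa using h₁, by simpa using h₂, StackTop.stack_self _⟩)
  exact ⟨_, step_clear w T p, _, step_mark w T true p, _, step_link hT b p, _,
    step_up hT (by omega) hmem, runs_finish hT'⟩

/-! ### The initial state -/

theorem startStr_fn {τ : Schema} {I : Type} {sg : I → OpSig} {σ : OpSig} (D : Rules τ sg σ)
    (f : τ.Fn) (b : Fin (τ.fnAr f) → Fin n) (v : Fin n)
    (h : ∀ u u', (D.fnStart f).Realize (Fin.snoc b u : Fin (τ.fnAr f + 1) → Fin n) →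
      (D.fnStart f).Realize (Fin.snoc b u' : Fin (τ.fnAr f + 1) → Fin n) → u = u') :
    (D.startStr n).fn f b = some v ↔
      (D.fnStart f).Realize (Fin.snoc b v : Fin (τ.fnAr f + 1) → Fin n) := by
  unfold Rules.startStr
  dsimp only
  split_ifs with hex
  · rw [Option.some.injEq]
    constructor
    · intro e
      rw [← e]
      exact hex.choose_spec.1
    · intro hv
      exact h _ _ hex.choose_spec.1 hv
  · simp only [false_iff]
    exact fun hv => hex ⟨v, hv, fun u hu => h _ _ hu hv⟩

theorem inv_start : Inv (fun _ => none) (machine k n).start.1 := by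
  have hext : extend (fun _ : Fin n => (none : Option (Paren k))) = fun _ => none := by
    funext x
    unfold extend
    split_ifs <;> rfl
  have hrel : ∀ R b, ¬ ((rules k).startStr n).rel R b := fun R b h => by
    simp [Rules.startStr, rules] at h
  have hfn : ∀ (f : FnSym) (Z : Fin n → Fin n → Prop) (x v : Fin n),
      (∀ u, (fnStart f).Realize (Fin.snoc (fun _ : Fin 1 => x) u : Fin 2 → Fin n) ↔ Z x u) →
      (∀ u u', Z x u → Z x u' → u = u') →
      (((rules k).startStr n).fn f (fun _ => x) = some v ↔ Z x v) := by
    intro f Z x v h hu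
    refine (startStr_fn (rules k) f (fun _ => x) v fun u u' h₁ h₂ => ?_).trans (h v)
    exact hu u u' ((h u).1 h₁) ((h u').1 h₂)
  -- For the empty word the top is `-1` everywhere on `[n]`, so `real` is nowhere defined and `virt`
  -- is constantly `0`.
  refine ⟨_, hext ▸ StackTop.empty, fun σ x => ?_, ⟨fun x y => ?_, fun x j h => ?_, fun i j => ?_,
    fun i j => ?_⟩, fun z => ?_⟩
  · simp only [reduceCtorEq, iff_false]
    exact hrel _ _
  · refine (hfn .real (fun _ _ => False) x y (fun u => ?_) ?_).trans ?_
    · simp [fnStart]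
    · simp
    · simp only [false_iff]
      omega
  · refine (hfn .virt (fun _ u => (u : ℕ) = 0) x j (fun u => ?_) ?_).2 (by omega)
    · simp [fnStart, realize_zeroFormula, Fin.snoc]
    · omega
  · refine hfn .pred (fun i j => (i : ℕ) = j + 1) i j (fun u => ?_) ?_
    · simp [fnStart, realize_succFormula, Fin.snoc]
    · omega
  · refine hfn .succ (fun i j => (j : ℕ) = i + 1) i j (fun u => ?_) ?_
    · simp [fnStart, realize_succFormula, Fin.snoc]
    · omega
  · simp only [reduceCtorEq, exists_false, false_and, iff_false]
    exact hrel _ _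

/-! ### Queries -/

theorem rq_letter (σ : Paren k) (b : Fin 1 → Fin n) (s : (machine k n).State) :
    (machine k n).rq (some σ) b s ↔ s.1.rel (some σ) fun _ => b 0 := by
  change (letter σ (.pvar 0)).eval _ _ _ ↔ _
  simp [letter, Expr.eval]

theorem rqOk_letter (σ : Paren k) (b : Fin 1 → Fin n) (s : (machine k n).State) :
    (machine k n).rqOk (some σ) b s :=
  fun _ => trivial

theorem simple_balanced_body :
    (.or (.and (opening (.zvar 0)) (.not (closed (.zvar 0))))
      (.and (closing (.zvar 0)) (.not (matching (app .real (.zvar 0)) (.zvar 0)))) :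
        Ex k 0 0 .cond 1).Simple := by
  refine ⟨⟨Expr.simple_disj fun c hc => ?_, fun _ => trivial⟩,
    Expr.simple_disj fun c hc => ?_, Expr.simple_disj fun c hc => ?_⟩
  all_goals obtain ⟨i, _, rfl⟩ := List.mem_map.1 hc
  all_goals simp [letter, app, Expr.Simple]

theorem rqOk_balanced (b : Fin 0 → Fin n) (s : (machine k n).State) :
    (machine k n).rqOk none b s :=
  fun _ _ => simple_balanced_body.ok _ _ _

theorem eval_balanced {M : (i : Empty) → Machine (noSig i) n} (E : Env (schema k) M 0 0)
    (L : Str Schema.nil n) (z : Fin 0 → Fin n) :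
    balanced.eval E L z ↔ ∀ z : Fin n,
      (∀ i, E.aux.rel (some (.inl i)) (fun _ => z) → E.aux.rel none fun _ => z) ∧
      ∀ i, E.aux.rel (some (.inr i)) (fun _ => z) →
        ∃ j, (∃ y, E.aux.fn .real (fun _ => z) = some y ∧ E.aux.rel (some (.inl j)) fun _ => y) ∧
          E.aux.rel (some (.inr j)) fun _ => z := by
  simp only [balanced, Expr.eval, eval_opening, eval_closing, eval_matching, eval_closed,
    eval_app, Bound.all]
  simp [Fin.snoc, (Fin.is_lt _).le, ← exists_and_right, and_assoc]

theorem rq_balanced {w : Fin n → Option (Paren k)} (b : Fin 0 → Fin n)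
    (s : (machine k n).State) (h : Inv w s.1) :
    (machine k n).rq none b s ↔ WellBalanced (wordOf w) := by
  obtain ⟨T, hT, hw, ht, hm⟩ := h
  have h₁ : (machine k n).rq none b s ↔ ∀ z : Fin n,
      (∀ i, w z = some (.inl i) → s.1.rel none fun _ => z) ∧
      ∀ i, w z = some (.inr i) → ∃ j, (∃ y, s.1.fn .real (fun _ => z) = some y ∧
        w y = some (.inl j)) ∧ w z = some (.inr j) := by
    refine (eval_balanced _ _ _).trans (forall_congr' fun z => ?_)
    simp only [← hw _ _]
  have h₂ : ∀ (z : Fin n) j, (∃ y, s.1.fn .real (fun _ => z) = some y ∧ w y = some (.inl j)) ↔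
      extend w (T (z : ℕ)) = some (.inl j) := by
    intro z j
    constructor
    · rintro ⟨y, hy, hj⟩
      rw [(ht.real z y).1 hy, extend_coe, hj]
    · intro h
      obtain ⟨y, hy⟩ := exists_fin_of_extend h
      exact ⟨y, (ht.real z y).2 hy, by rwa [hy, extend_coe] at h⟩
  rw [h₁, hT.wellBalanced_iff, forall_and, and_comm]
  refine and_congr (forall_congr' fun c => forall_congr' fun i => forall_congr' fun hc => ?_)
    (forall_congr' fun z => forall_congr' fun i => forall_congr' fun hz => ?_)
  · simp [h₂, hc]
  · rw [hm]
    simp only [← exists_and_right]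

/-! ### Work -/

theorem chgWork_le (c : Op k) : (machine k n).chgWork c ≤ n + 1 := by
  refine max_le (Finset.sup_le fun R _ => ?_) (Finset.sup_le fun f _ => ?_)
  · rcases h : (rules k).updRel c R with _ | r
    · simp
    · obtain ⟨t, v, ht, hv, rfl⟩ := updRel_eq_rule (c := c) (R := R) h
      exact work_rule ht hv
  · rcases h : (rules k).updFn c f with _ | r
    · simp
    · obtain ⟨t, v, ht, hv, rfl, _⟩ := updFn_eq_rule (c := c) (f := f) h
      exact work_rule ht hv

theorem rqWork_le (q : Option (Paren k)) : (machine k n).rqWork q ≤ n + 1 := by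
  rcases q with _ | σ
  · exact (Nat.mul_le_mul le_rfl (simple_balanced_body.work_le _)).trans (by simp [Bound.all])
  · refine ((?_ : (letter σ (.pvar 0) : Ex k 1 0 .cond 0).Simple).work_le _).trans (by omega)
    exact fun _ => trivial

end StackProgram

/-! ### The program for `Member(D_k)` -/

namespace DyckProgram

open StackProgram (Op Inv machine Runs Step)

variable {k n : ℕ}

/-- A single relation, whose update rules invoke the supplementary instance. -/
abbrev schema : Schema where
  Rel := Unit
  Fn := Empty
  relAr := fun _ => 0
  fnAr := fun _ => 0

/-- The operations of `Member(D_k)`. -/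
noncomputable abbrev sig (k : ℕ) : OpSig := (memberProblem (dyck k)).sig

/-- The operations of the supplementary instance. -/
abbrev sub (k : ℕ) (_ : Unit) : OpSig := StackProgram.sig k

/-- Initial procedures of the program. -/
abbrev Proc (k : ℕ) : Type := InitProc schema Schema.nil (sub k) 1

/-- The letter at the parameter is one of `σs`. -/
def letterIn (σs : List (Paren k)) : Expr schema Schema.nil (sub k) 1 0 .cond 0 :=
  .disj (σs.map fun σ => .rq () (some σ) fun _ => .pvar (0 : Fin 1))

/-- Invocation of a sequence of operations of the supplementary instance. -/
def invokeAll : List (Op k) → Proc k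
  | [] => .instr .skip
  | c :: cs => .seq (.invoke () c fun _ => .pvar (0 : Fin 1)) (invokeAll cs)

/-- The opening parentheses. -/
def openings (k : ℕ) : List (Paren k) := (List.finRange k).map Sum.inl

/-- The closing parentheses. -/
def closings (k : ℕ) : List (Paren k) := (List.finRange k).map Sum.inr

/-- An opening parenthesis is inserted, if `b` is true, or a closing one is deleted. -/
def goUp (b : Bool) (o : Option (Paren k)) : Proc k :=
  invokeAll (.clear :: .mark true :: .link b :: .up :: StackProgram.finish o)

/-- A closing parenthesis is inserted or an opening one is deleted. -/
def goDown (o : Option (Paren k)) : Proc k := invokeAll (.down :: StackProgram.finish o)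

/-- The initial procedure for the operation `c`. -/
def init : (c : Option (Paren k)) → Proc k
  | some (.inl i) => .ite (letterIn (openings k ++ closings k)) (invokeAll [])
      (goUp true (some (.inl i)))
  | some (.inr i) => .ite (letterIn (openings k ++ closings k)) (invokeAll [])
      (goDown (some (.inr i)))
  | none => .ite (letterIn (openings k)) (goDown none)
      (.ite (letterIn (closings k)) (goUp false none) (invokeAll []))

/-- The update rule for the operation `c`. -/
def rule (c : Option (Paren k)) : UpdateRule schema (sub k) 1 .cond 0 where
  loc := Schema.nil
  init := init c
  l := 0
  bound := fun i => i.elim0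
  head := fun i => i.elim0
  main := .ret (.eq .bot .bot)

/-- The rules. -/
def rules (k : ℕ) : Rules schema (sub k) (sig k) where
  relStart := fun _ => ⊥
  fnStart := fun f => f.elim
  updRel := fun c _ => some (rule c)
  updFn := fun _ f => f.elim
  rq := fun _ => ⟨Schema.nil, .ret (.rq () none fun i => i.elim0)⟩
  fq := fun q => q.elim

/-- The program. -/
noncomputable def program (k : ℕ) : Program (sig k) :=
  .mk schema Unit inferInstance (sub k) (fun _ => StackProgram.program k) (rules k)
    fun _ _ s s' _ _ => by
      rcases s with ⟨⟩ | f
      · rcases s' with ⟨⟩ | f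
        · rfl
        · exact f.elim
      · exact f.elim

theorem machine_program : (program k).machine n =
    (rules k).machine fun _ : Unit => machine k n := by
  have h : (StackProgram.program k).machine n = machine k n := by
    unfold StackProgram.program machine
    simp only [Program.machine]
    congr 1
    funext i
    exact i.elim
  unfold program
  simp only [Program.machine, h]

/-- If the supplementary instance represents `w` before the procedure, then the procedure is executed
properly and it represents `w'` afterwards. -/
def Triple (p : Fin 1 → Fin n) (A : Str (StackProgram.schema k) n → Prop) (Q : Proc k)
    (B : Str (StackProgram.schema k) n → Prop) : Prop :=
  ∀ (aux : Str schema n) (L : LState Schema.nil n) (S : Unit → (machine k n).State), A (S ()).1 →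
    Q.Ok (M := fun _ => machine k n) aux p (L, S) ∧
    B ((Q.exec (M := fun _ => machine k n) aux p (L, S)).2 ()).1

/-- Invocations in an initial procedure act on the supplementary instance at once, so each operation
sees the result of the previous one. -/
theorem triple_invokeAll (p : Fin 1 → Fin n) (cs : List (Op k)) :
    ∀ {A B}, Runs (p 0) cs A B → Triple p A (invokeAll cs) B := by
  induction cs with
  | nil => intro A B h aux L S hA; exact ⟨trivial, h _ hA⟩
  | cons c cs ih =>
    rintro A B ⟨C, hc, hcs⟩ aux L S hA
    obtain ⟨h₁, h₂⟩ := hc (S ()) hA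
    have hv : ∀ E : Env schema (fun _ : Unit => machine k n) 1 0, E.p = p →
        (tuple fun _ : Fin 1 => (Expr.pvar (0 : Fin 1) :
          Expr schema Schema.nil (sub k) 1 0 .term 0).eval E L.toStr Fin.elim0) =
        some fun _ => p 0 := by
      rintro E rfl
      simp [Expr.eval]
    have he : (InitProc.invoke () c fun _ => .pvar (0 : Fin 1) : Proc k).exec
        (M := fun _ => machine k n) aux p (L, S) =
        (L, Function.update S () ((machine k n).chg c (fun _ => p 0) (S ()))) := by
      rw [InitProc.exec]
      erw [hv _ rfl]
      dsimp only
      congr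
      -- The two sides differ only in the decidability instance inside `Function.update`.
      exact Subsingleton.elim _ _
    obtain ⟨h₃, h₄⟩ := ih hcs aux L
      (Function.update S () ((machine k n).chg c (fun _ => p 0) (S ())))
      (by simpa using h₂)
    refine ⟨⟨⟨fun _ => trivial, fun b hb => ?_⟩, ?_⟩, ?_⟩
    · erw [hv _ rfl] at hb
      obtain rfl := Option.some.inj hb
      exact h₁
    · rwa [he]
    · rw [invokeAll, InitProc.exec, he]
      exact h₄

/-- The main program stores no letters; it asks the supplementary instance, which is still in its
old state when the test is made. -/
theorem triple_ite {w : Fin n → Option (Paren k)} {p : Fin 1 → Fin n} {σs : List (Paren k)}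
    {Q R : Proc k} {B : Str (StackProgram.schema k) n → Prop}
    (hQ : (∃ σ ∈ σs, w (p 0) = some σ) → Triple p (Inv w) Q B)
    (hR : (¬ ∃ σ ∈ σs, w (p 0) = some σ) → Triple p (Inv w) R B) :
    Triple p (Inv w) (.ite (letterIn σs) Q R) B := by
  intro aux L S hA
  have hc : ∀ E : Env schema (fun _ : Unit => machine k n) 1 0, E.p = p → E.inst = S →
      ((letterIn σs).eval E L.toStr Fin.elim0 ↔ ∃ σ ∈ σs, w (p 0) = some σ) := by
    rintro E rfl rfl
    obtain ⟨T, _, hw, _⟩ := hA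
    rw [letterIn, Expr.eval_disj]
    simp only [List.mem_map, exists_exists_and_eq_and]
    refine exists_congr fun σ => and_congr_right fun _ => ?_
    rw [← hw]
    have : ∀ b, tuple (fun _ : Fin 1 => some (E.p 0)) = some b ↔ b = fun _ => E.p 0 := by
      intro b
      simp [eq_comm]
    constructor
    · rintro ⟨b, hb, h⟩
      obtain rfl := (this b).1 hb
      exact (StackProgram.rq_letter σ _ _).1 h
    · intro h
      exact ⟨_, (this _).2 rfl, (StackProgram.rq_letter σ _ _).2 h⟩
  have hok : ∀ E : Env schema (fun _ : Unit => machine k n) 1 0,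
      (letterIn σs).Ok E L.toStr Fin.elim0 := by
    intro E
    refine Expr.ok_disj _ _ _ fun c hc => ?_
    obtain ⟨σ, _, rfl⟩ := List.mem_map.1 hc
    exact ⟨fun _ => trivial, fun b _ => StackProgram.rqOk_letter σ b _⟩
  by_cases h : ∃ σ ∈ σs, w (p 0) = some σ
  · obtain ⟨h₁, h₂⟩ := hQ h aux L S hA
    refine ⟨⟨hok _, fun _ => h₁, fun h' => absurd ((hc _ rfl rfl).2 h) h'⟩, ?_⟩
    rw [InitProc.exec, if_pos ((hc _ rfl rfl).2 h)]
    exact h₂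
  · obtain ⟨h₁, h₂⟩ := hR h aux L S hA
    refine ⟨⟨hok _, fun h' => absurd ((hc _ rfl rfl).1 h') h, fun _ => h₁⟩, ?_⟩
    rw [InitProc.exec, if_neg (fun h' => h ((hc _ rfl rfl).1 h'))]
    exact h₂

theorem triple_goUp {w : Fin n → Option (Paren k)} {p : Fin 1 → Fin n} {o : Option (Paren k)}
    {b : Bool} (h : (w (p 0) = none ∧ (∃ i, o = some (.inl i)) ∧ b = true) ∨
      (o = none ∧ (∃ i, w (p 0) = some (.inr i)) ∧ b = false)) :
    Triple p (Inv w) (goUp b o) (Inv (Function.update w (p 0) o)) := by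
  rintro aux L S ⟨T, hT, hw, ht, _⟩
  exact triple_invokeAll p _ (StackProgram.runs_up hT h) aux L S ⟨hw, ht⟩

theorem triple_goDown {w : Fin n → Option (Paren k)} {p : Fin 1 → Fin n} {o : Option (Paren k)}
    (h : (w (p 0) = none ∧ ∃ i, o = some (.inr i)) ∨
      (o = none ∧ ∃ i, w (p 0) = some (.inl i))) :
    Triple p (Inv w) (goDown o) (Inv (Function.update w (p 0) o)) := by
  rintro aux L S ⟨T, hT, hw, ht, _⟩
  exact triple_invokeAll p _ (StackProgram.runs_down hT h) aux L S ⟨hw, ht⟩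

theorem exists_letter_iff (w : Option (Paren k)) :
    (∃ σ ∈ openings k ++ closings k, w = some σ) ↔ w ≠ none := by
  rcases w with _ | i | i <;> simp [openings, closings]

theorem triple_init (c : Option (Paren k)) (p : Fin 1 → Fin n) (w : Fin n → Option (Paren k)) :
    Triple p (Inv w) (init c) (Inv ((memberProblem (dyck k)).chg c p w)) := by
  have hset : ∀ σ, (memberProblem (dyck k)).chg (n := n) (some σ) p w =
      if w (p 0) = none then Function.update w (p 0) (some σ) else w := by
    intro σ
    simp only [memberProblem]
  have hreset : (memberProblem (dyck k)).chg (n := n) none p w =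
      Function.update w (p 0) none := by
    simp only [memberProblem]
  have hid : ∀ A : Str (StackProgram.schema k) n → Prop, Triple p A (invokeAll []) A :=
    fun A => triple_invokeAll p [] fun _ h => h
  rcases c with _ | i | i
  · rw [hreset]
    refine triple_ite (fun h => ?_) fun h => triple_ite (fun h' => ?_) fun h' => ?_
    · exact triple_goDown (.inr ⟨rfl, by simpa [openings] using h⟩)
    · exact triple_goUp (.inr ⟨rfl, by simpa [closings] using h', rfl⟩)
    · have : w (p 0) = none := by
        by_contra hne
        obtain ⟨σ, hσ, e⟩ := (exists_letter_iff _).2 hne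
        rcases List.mem_append.1 hσ with hσ | hσ
        · exact h ⟨σ, hσ, e⟩
        · exact h' ⟨σ, hσ, e⟩
      rw [Function.update_eq_self_iff.2 this.symm]
      exact hid _
  · rw [hset]
    refine triple_ite (fun h => ?_) fun h => ?_
    · rw [if_neg ((exists_letter_iff _).1 h)]
      exact hid _
    · rw [exists_letter_iff, not_not] at h
      rw [if_pos h]
      exact triple_goUp (.inl ⟨h, ⟨i, rfl⟩, rfl⟩)
  · rw [hset]
    refine triple_ite (fun h => ?_) fun h => ?_
    · rw [if_neg ((exists_letter_iff _).1 h)]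
      exact hid _
    · rw [exists_letter_iff, not_not] at h
      rw [if_pos h]
      exact triple_goDown (.inl ⟨h, i, rfl⟩)

theorem invokes (c : Option (Paren k)) : (rules k).Invokes c () (.inl ()) := by
  refine ⟨rule c, rfl, ?_⟩
  rcases c with _ | i | i <;>
    simp [rule, init, goUp, goDown, invokeAll, StackProgram.finish, InitProc.Invokes]

/-- The program on the domain `[n]`. -/
noncomputable abbrev whole (k n : ℕ) : Machine (sig k) n :=
  (rules k).machine fun _ : Unit => machine k n

theorem chg_spec (c : Option (Paren k)) (p : Fin 1 → Fin n) (w : Fin n → Option (Paren k))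
    (s : (whole k n).State) (h : Inv w (s.2 ()).1) :
    (whole k n).chgOk c p s ∧
      Inv ((memberProblem (dyck k)).chg c p w) (((whole k n).chg c p s).2 ()).1 := by
  obtain ⟨aux, S⟩ := s
  obtain ⟨h₁, h₂⟩ := triple_init c p w aux (LState.nil Schema.nil n) S h
  refine ⟨⟨fun R r hr => ?_, fun f => f.elim⟩, ?_⟩
  · obtain rfl := Option.some.inj hr
    exact ⟨h₁, fun x _ => ⟨fun j => j.elim0, trivial, trivial⟩, fun h => by cases h⟩
  · change Inv _ ((rules k).newInst c p aux S ()).1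
    have hex : ∃ s, (rules k).Invokes c () s := ⟨_, invokes c⟩
    have e : (rules k).newInst c p aux S () = (rules k).instAfter c p aux S hex.choose () :=
      dif_pos hex
    rw [e]
    -- There is only one auxiliary symbol, so the chosen invoking rule is the intended one.
    rcases hex.choose with ⟨⟩ | f
    · exact h₂
    · exact f.elim

theorem inv_after (α : List ((c : (sig k).Chg) × (Fin ((sig k).chgAr c) → Fin n))) :
    Inv ((memberProblem (dyck k)).after n α) (((whole k n).after α).2 ()).1 := by
  have key : ∀ (w : Fin n → Option (Paren k)) (s : (whole k n).State), Inv w (s.2 ()).1 →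
      Inv (α.foldl (fun d δ => (memberProblem (dyck k)).chg δ.1 δ.2 d) w)
        ((α.foldl (fun s δ => (whole k n).chg δ.1 δ.2 s) s).2 ()).1 := by
    induction α with
    | nil => exact fun _ _ h => h
    | cons δ α ih => exact fun w s h => ih _ _ (chg_spec δ.1 δ.2 w s h).2
  exact key _ _ StackProgram.inv_start

theorem isFor (k : ℕ) : (program k).IsFor (memberProblem (dyck k)) := by
  intro n α
  rw [machine_program]
  have h := inv_after (k := k) (n := n) α
  refine ⟨fun q p => ?_, fun q => q.elim, fun c p => (chg_spec c p _ _ h).1, fun q p => ?_,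
    fun q => q.elim⟩
  · have h' := fun b => StackProgram.rq_balanced b (((whole k n).after α).2 ()) h
    constructor
    · rintro ⟨b, _, hb⟩
      exact (h' b).1 hb
    · intro hw
      exact ⟨fun j => j.elim0, tuple_zero _, (h' _).2 hw⟩
  · exact ⟨fun j => j.elim0, fun b _ => StackProgram.rqOk_balanced b _⟩

theorem work_invokeAll_le (cs : List (Op k)) :
    (invokeAll cs).work (fun _ => machine k n) ≤ n + 1 := by
  induction cs with
  | nil => simp [invokeAll, InitProc.work, Instr.work]
  | cons c cs ih =>
    refine max_le (max_le (StackProgram.chgWork_le c) (Finset.sup_le fun _ _ => ?_)) ih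
    simp [Expr.work]

theorem work_letterIn_le (σs : List (Paren k)) :
    (letterIn σs).work (fun _ => machine k n) ≤ n + 1 := by
  refine Expr.work_disj_le _ (by omega) fun c hc => ?_
  obtain ⟨σ, _, rfl⟩ := List.mem_map.1 hc
  refine max_le (StackProgram.rqWork_le _) (Finset.sup_le fun _ _ => ?_)
  simp [Expr.work]

theorem work_init_le (c : Option (Paren k)) :
    (init c).work (fun _ => machine k n) ≤ n + 1 := by
  rcases c with _ | i | i
  · exact max_le (work_letterIn_le _) (max_le (work_invokeAll_le _)
      (max_le (work_letterIn_le _) (max_le (work_invokeAll_le _) (work_invokeAll_le _))))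
  · exact max_le (work_letterIn_le _) (max_le (work_invokeAll_le _) (work_invokeAll_le _))
  · exact max_le (work_letterIn_le _) (max_le (work_invokeAll_le _) (work_invokeAll_le _))

theorem chgWork_le (c : Option (Paren k)) : (whole k n).chgWork c ≤ n + 1 := by
  refine max_le (Finset.sup_le fun R _ => ?_) (Finset.sup_le fun f _ => f.elim)
  refine max_le (work_init_le c) ?_
  have h : (∏ i : Fin 0, (((rule c).bound i).fn n + 1)) = 1 := rfl
  erw [h]
  simp [rule, MainProc.work, Expr.work]

theorem rqWork_le (q : Unit) : (whole k n).rqWork q ≤ n + 1 :=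
  max_le (StackProgram.rqWork_le _) (Finset.sup_le fun j _ => j.elim0)

/-- Every operation has work at most `n + 1`. -/
theorem hasWork (k : ℕ) {W : ℕ → ℝ} (hW : (fun n : ℕ => (n : ℝ) + 1) =O[atTop] W) :
    (program k).HasWork W := by
  have key : ∀ f : ℕ → ℕ, (∀ n, f n ≤ n + 1) → (fun n => (f n : ℝ)) =O[atTop] W := by
    intro f hf
    refine (IsBigO.of_bound 1 (Eventually.of_forall fun n => ?_)).trans hW
    have : (f n : ℝ) ≤ n + 1 := by exact_mod_cast hf n
    rw [Real.norm_of_nonneg (by positivity), Real.norm_of_nonneg (by positivity), one_mul]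
    exact this
  refine ⟨fun c => key _ fun n => ?_, fun q => key _ fun n => ?_, fun q => q.elim⟩
  · rw [machine_program]
    exact chgWork_le c
  · rw [machine_program]
    exact rqWork_le q

end DyckProgram

theorem isBigO_linear : (fun n : ℕ => (n : ℝ) + 1) =O[atTop]
    fun n : ℕ => (n : ℝ) * Real.log n + Real.log n ^ 3 := by
  refine IsBigO.of_bound 2 ((eventually_ge_atTop 3).mono fun n hn => ?_)
  have hn' : (3 : ℝ) ≤ n := by exact_mod_cast hn
  -- From `n ≥ 3 > e` on, `log n ≥ 1`, so the term `n log n` alone dominates the linear work.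
  have hlog : 1 ≤ Real.log n := by
    rw [Real.le_log_iff_exp_le (by linarith)]
    exact Real.exp_one_lt_three.le.trans hn'
  have h₁ : (n : ℝ) ≤ n * Real.log n := le_mul_of_one_le_right (by linarith) hlog
  have h₂ : 0 ≤ Real.log n ^ 3 := by positivity
  rw [Real.norm_of_nonneg (by positivity), Real.norm_of_nonneg (by positivity)]
  linarith

theorem mainTheorem8 (k : ℕ) :
    MaintainableInDynFO (memberProblem (dyck k))
      (fun n : ℕ => (n : ℝ) * Real.log n + Real.log n ^ 3) :=
  ⟨DyckProgram.program k, DyckProgram.isFor k, DyckProgram.hasWork k isBigO_linear⟩
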